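/- Identify a pair $(\theta_1,\theta_2)$ with $0<\theta_1,\theta_2<\frac{\pi}{2}$ with the triangle (up to similarity) that has angles $\theta_1,\theta_2,\pi-\theta_1-\theta_2$, its three edges being labelled $1,2,3$ so that edge $1$ is opposite the angle $\theta_1$, edge $2$ is opposite $\theta_2$, and edge $3$ (the base) is opposite the third angle. A periodic trajectory in a triangle $P$ is a closed path $f:[0,1]\to P$, starting on an edge, with constant non-zero derivative in the interior of $P$, except at the finitely many times when it strikes an edge; edges are never struck at a vertex, and at each strike (including the closing one at $f(0)=f(1)$) the derivative is reflected across the edge. The sequence $\sigma_1\cdots\sigma_k$ of labels of the edges struck during one traversal is the combinatorial type of $f$, where a sequence and its reversal are considered equivalent. The orbit tile $\mathcal O(C)$ of a combinatorial type $C$ is the set of all pairs $(\theta_1,\theta_2)$ as above whose triangle admits a periodic trajectory with combinatorial type $C$. Let $C$ be a combinatorial type such that $\mathcal O(C)$ contains an isosceles triangle $(\theta,\theta)$ whose base angle $\theta$ is either an irrational multiple of $\pi$ or of the form $\frac{a}{b}\pi$ with $a,b$ coprime integers and $b$ even. Then $\mathcal O(C)$ is symmetric under reflection across the line of isosceles triangles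 $\theta_1=\theta_2$: for all $(\theta_1,\theta_2)$, one has $(\theta_1,\theta_2)\in\mathcal O(C)$ if and only if $(\theta_2,\theta_1)\in\mathcal O(C)$. -/

import Mathlib

open Real

noncomputable section

/-- The space of triangles: pairs `(θ₁, θ₂)` with `0 < θ₁, θ₂ < π / 2`, standing for the triangle
with labelled angles `θ₁`, `θ₂`, `π - θ₁ - θ₂` (up to similarity). -/
def triangleSpace : Set (ℝ × ℝ) :=
  {T | 0 < T.1 ∧ T.1 < π / 2 ∧ 0 < T.2 ∧ T.2 < π / 2}

/-- The line of isosceles triangles: those with equal base angles `θ₁ = θ₂`. -/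
def isoscelesLine : Set (ℝ × ℝ) :=
  {T | T ∈ triangleSpace ∧ T.1 = T.2}

/-- The vertices of a triangle with the angles `θ₁`, `θ₂`, `π - θ₁ - θ₂` at the vertices
`0`, `1`, `2` respectively. The base lies on the real axis; the side opposite each vertex has length
the sine of the angle there. See `triangleVertex_angles`. -/
def triangleVertex (T : ℝ × ℝ) : Fin 3 → ℂ :=
  ![0, (sin (T.1 + T.2) : ℂ), (sin T.2 : ℂ) * Complex.exp (T.1 * Complex.I)]

/-- The triangle (closed region) with vertices `v 0`, `v 1`, `v 2`. -/
def triangleRegion (v : Fin 3 → ℂ) : Set ℂ := convexHull ℝ (Set.range v)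

/-- Edge `i` without its endpoints; edge `i` is the one opposite to vertex `i`. Thus edge `2` is
the base, and edges `0` and `1` are the two congruent sides of an isosceles triangle. -/
def openEdge (v : Fin 3 → ℂ) (i : Fin 3) : Set ℂ := openSegment ℝ (v (i + 1)) (v (i + 2))

/-- The linear part of the reflection across edge `i`. -/
def edgeReflection (v : Fin 3 → ℂ) (i : Fin 3) : ℂ → ℂ :=
  (Submodule.span ℝ {v (i + 2) - v (i + 1)}).reflection

/-- A periodic billiard trajectory `path : [0,1] → P` in the triangle `P` with vertices `v`,
starting on an edge. It strikes the edges `edge 0, …, edge (n - 1)` successively at the times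
`0 = time 0 < ⋯ < time (n - 1) < 1`, and at `time n = 1` it is back at its starting point, which
it leaves again with its initial velocity. Only the values of `path` on `[0,1]` matter, and those
of `time`, `edge`, `velocity` at indices `≤ n`. -/
structure PeriodicTrajectory (v : Fin 3 → ℂ) where
  path : ℝ → ℂ
  n : ℕ
  time : ℕ → ℝ
  edge : ℕ → Fin 3
  velocity : ℕ → ℂ
  time_zero : time 0 = 0
  time_last : time n = 1
  time_lt : ∀ i < n, time i < time (i + 1)
  /-- The edges are struck away from the vertices. -/
  path_time : ∀ i ≤ n, path (time i) ∈ openEdge v (edge i)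
  /-- Between successive strikes the path has constant derivative ... -/
  path_eq : ∀ i < n, ∀ s ∈ Set.Icc (time i) (time (i + 1)),
    path s = path (time i) + (s - time i) • velocity i
  /-- ... and stays in the interior of the triangle. -/
  path_interior : ∀ i < n, ∀ s ∈ Set.Ioo (time i) (time (i + 1)),
    path s ∈ interior (triangleRegion v)
  /-- At each strike the derivative is reflected across the edge (so the speed is constant). -/
  velocity_succ : ∀ i < n, velocity (i + 1) = edgeReflection v (edge (i + 1)) (velocity i)
  /-- The speed is not zero. -/
  velocity_ne_zero : velocity 0 ≠ 0
  path_closed : path 1 = path 0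
  edge_closed : edge n = edge 0
  velocity_closed : velocity n = velocity 0

/-- The sequence of edges struck by a periodic trajectory, over one traversal. -/
def PeriodicTrajectory.edgeSequence {v : Fin 3 → ℂ} (f : PeriodicTrajectory v) : List (Fin 3) :=
  (List.range f.n).map f.edge

/-- Two edge sequences are the same combinatorial type if they are identical or one is obtained by
reversing the other. -/
def SameCombinatorialType (w w' : List (Fin 3)) : Prop := w = w' ∨ w = w'.reverse

/-- The orbit tile of (the combinatorial type given by) an edge sequence `C`: the triangles
admitting a periodic trajectory of combinatorial type `C`. -/
def orbitTile (C : List (Fin 3)) : Set (ℝ × ℝ) :=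
  {T | T ∈ triangleSpace ∧
    ∃ f : PeriodicTrajectory (triangleVertex T), SameCombinatorialType f.edgeSequence C}

/-- The base angle is an irrational multiple of `π`, or is `(a / b) π` with `a / b` in lowest terms
and `b` even. -/
def BaseAngleCondition (θ : ℝ) : Prop :=
  Irrational (θ / π) ∨
    ∃ a b : ℤ, b ≠ 0 ∧ IsCoprime a b ∧ Even b ∧ θ = (a : ℝ) / (b : ℝ) * π

/-- `triangleVertex T` has the prescribed angles. -/
theorem triangleVertex_angles {T : ℝ × ℝ} (hT : T ∈ triangleSpace) :
    EuclideanGeometry.angle (triangleVertex T 1) (triangleVertex T 0) (triangleVertex T 2) = T.1 ∧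
    EuclideanGeometry.angle (triangleVertex T 0) (triangleVertex T 1) (triangleVertex T 2) = T.2 ∧
    EuclideanGeometry.angle (triangleVertex T 0) (triangleVertex T 2) (triangleVertex T 1) =
      π - T.1 - T.2 := by
  obtain ⟨h1, h1', h2, h2'⟩ := hT
  obtain ⟨x, y⟩ := T
  simp only at *
  have hs1 : 0 < sin x := sin_pos_of_pos_of_lt_pi h1 (by linarith)
  have hs2 : 0 < sin y := sin_pos_of_pos_of_lt_pi h2 (by linarith)
  have hs : 0 < sin (x + y) := sin_pos_of_pos_of_lt_pi (by linarith) (by linarith)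
  have e2 : triangleVertex (x, y) 2 - triangleVertex (x, y) 1
      = ((-sin x : ℝ) : ℂ) * Complex.exp ((-y : ℝ) * Complex.I) := by
    rw [Complex.exp_mul_I]
    apply Complex.ext <;>
      simp [triangleVertex, Complex.exp_re, Complex.exp_im, ← Complex.ofReal_cos,
        ← Complex.ofReal_sin, sin_add] <;> ring
  have a1 : EuclideanGeometry.angle (triangleVertex (x, y) 1) (triangleVertex (x, y) 0)
      (triangleVertex (x, y) 2) = x := by
    have : triangleVertex (x, y) 2 - triangleVertex (x, y) 0
        = (sin y) • Complex.exp (x * Complex.I) := by simp [triangleVertex]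
    have e1 : triangleVertex (x, y) 1 - triangleVertex (x, y) 0
        = (sin (x + y)) • Complex.exp ((0 : ℝ) * Complex.I) := by simp [triangleVertex]
    rw [EuclideanGeometry.angle, vsub_eq_sub, vsub_eq_sub, this, e1,
      InnerProductGeometry.angle_smul_left_of_pos _ _ hs,
      InnerProductGeometry.angle_smul_right_of_pos _ _ hs2, Complex.angle_exp_exp,
      (toIocMod_eq_self two_pi_pos).2 ⟨by linarith, by linarith⟩, zero_sub, abs_neg, abs_of_pos h1]
  have a2 : EuclideanGeometry.angle (triangleVertex (x, y) 0) (triangleVertex (x, y) 1)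
      (triangleVertex (x, y) 2) = y := by
    have : triangleVertex (x, y) 2 - triangleVertex (x, y) 1
        = (-sin x) • Complex.exp ((-y : ℝ) * Complex.I) := by rw [e2]; simp
    have e1 : triangleVertex (x, y) 0 - triangleVertex (x, y) 1
        = (-sin (x + y)) • Complex.exp ((0 : ℝ) * Complex.I) := by simp [triangleVertex]
    rw [EuclideanGeometry.angle, vsub_eq_sub, vsub_eq_sub, this, e1,
      InnerProductGeometry.angle_smul_left_of_neg _ _ (by linarith),
      InnerProductGeometry.angle_smul_right_of_neg _ _ (by linarith),
      InnerProductGeometry.angle_neg_neg, Complex.angle_exp_exp,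
      (toIocMod_eq_self two_pi_pos).2 ⟨by linarith, by linarith⟩, zero_sub, neg_neg, abs_of_pos h2]
  refine ⟨a1, a2, ?_⟩
  have hne : triangleVertex (x, y) 1 ≠ triangleVertex (x, y) 0 := by
    simp only [triangleVertex, Matrix.cons_val_one, Matrix.cons_val_zero]
    exact_mod_cast hs.ne'
  have hne2 : triangleVertex (x, y) 2 ≠ triangleVertex (x, y) 0 := by
    have : ((sin y : ℝ) : ℂ) ≠ 0 := by exact_mod_cast hs2.ne'
    simpa [triangleVertex, Complex.exp_ne_zero] using this
  have := EuclideanGeometry.angle_add_angle_add_angle_eq_pi (triangleVertex (x, y) 2) hne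
  rw [EuclideanGeometry.angle_comm (triangleVertex (x, y) 2) (triangleVertex (x, y) 0)] at this
  rw [EuclideanGeometry.angle_comm (triangleVertex (x, y) 0) (triangleVertex (x, y) 2)]
  rw [a1] at this
  linarith [a2]

end

/-!
Reflecting a trajectory in a mirror that carries the triangle `(θ₁, θ₂)` to `(θ₂, θ₁)` exchanges the
labels `0` and `1` of the edges and fixes the label `2` (`BilliardPolygon.mirrorImage`). Labels of
a periodic trajectory form a bi-infinite periodic sequence, and both shifts and reversals of it are
realised in the same triangle. It is therefore enough to show that the label sequence `e` of a
periodic trajectory in the given isosceles triangle is carried to its own exchange by a shift or by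
a reversal: `e (i + r)` or `e (r - i)` equals `Equiv.swap 0 1 (e i)`
(`BilliardPolygon.exists_swap_symmetry`).

Unfold the isosceles trajectory to a horizontal line. Successive copies of the triangle either share
a leg, and are then rotated into each other about the common apex by the apex angle `π - 2θ`, or
share the base, and are then exchanged by the half-turn about its midpoint. Up to translation, the
copies thus lie on a surface glued from fans of triangles around apices (`FanSurface`), with an
involution `inv` reversing horizontal lines; the trajectory is a closed horizontal leaf on it
(`FanPath.leaf`). The leaf and its image under `inv` run in opposite directions, so the crossings of
an arc by the one, minus those by the other, are the increments of a potential along the arc. A base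
is preserved by `inv`, so the potential is the same at all base vertices, say `0`; along every leg
it increases by one and the same integer `w`, the number of times the leaf winds around the fans
(`FanPath.leaf_hasFlux`), so it is `w` at the apices. Now widen the leaf to a maximal cylinder of
parallel closed leaves. Both boundaries contain vertices, so the signed number of crossings of
the width of the cylinder is a difference of two values of the potential, hence is `0`, `w` or `-w`
(`ClosedLeaf.HasFlux.exists_cylinder`). Two closed leaves in one cylinder coincide up to an offset,
which has to vanish for iterates of the same leaf. Hence either the reversed image lies in the
cylinder, and the leaf is its own reversed image, or the period of the leaf divides its length
exactly `|w|` times (`ClosedLeaf.HasFlux.exists_reverse_or_card`).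

* If the total rotation of the unfolding vanishes, one may take levels in `ℤ` and `w = 0`; the
  second alternative would be an empty count, so the leaf is its own reversed image. Comparing the
  directions of the tiles, the reversal is about an odd index, and gives a reversal of `e` that
  exchanges `0` and `1` (`FanPath.exists_reverse_of_turns_eq_zero`).
* If the total rotation is by `M ≠ 0` tiles, then `exp (-2iθM) = 1`. This excludes irrational
  multiples of `π`, and if `θ = (a / b) π` in lowest terms with `b` even, then `a` is odd, `N = b /
  2` tiles make `exp (-2iθN) = -1`, and `M = N w` with `w` even. A leaf that is its own reversed
  image has `M = 0`, so the leaf has period `n / |w|` and turns by exactly `±N` tiles in one period.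
  The sign `-1` forces this period to be odd, and a shift of `e` by an odd period exchanges `0` and
  `1` (`FanPath.exists_shift_of_turns_ne_zero`).
-/

noncomputable section
open scoped ComplexConjugate

/-! ### Closed leaves on surfaces glued from fans of triangles -/

theorem sum_range_intCast_add_one {M : Type*} [AddCommGroup M] {n : ℕ} {f : ℤ → M}
    (hf : Function.Periodic f n) :
    ∑ j ∈ Finset.range n, f ((j : ℤ) + 1) = ∑ j ∈ Finset.range n, f j := by
  have h1 := Finset.sum_range_succ (fun j : ℕ => f j) n
  have h2 := Finset.sum_range_succ' (fun j : ℕ => f j) n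
  have h3 : f n = f 0 := by simpa using hf 0
  simp only [Nat.cast_add, Nat.cast_one, Nat.cast_zero] at h1 h2
  rw [h1, h3] at h2
  exact (add_right_cancel h2).symm

/-- The combinatorics of horizontal flow on a surface tiled by congruent isosceles triangles. The
tiles, elements of `X`, are grouped in fans around their apices: `next x` is the next tile
counterclockwise around the apex of `x`, sharing with `x` the second leg of `x`, which is the first
leg of `next x`. Across its base `x` is glued to `inv x`, which is `x` turned by a half-turn.
`height x` is the vertical coordinate, relative to the apex, of the base vertex on the first leg;
the base vertex on the second leg thus has height `height (next x)`. -/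
structure FanSurface (X : Type*) where
  next : X → X
  inv : X → X
  height : X → ℝ
  next_injective : Function.Injective next
  inv_inv : ∀ x, inv (inv x) = x
  inv_next : ∀ x, inv (next x) = next (inv x)
  height_inv : ∀ x, height (inv x) = -height x

namespace FanSurface

variable {X : Type*} (F : FanSurface X)

/-- A horizontal line moving to the right, at vertical distance `t` above the apex of the tile `x`,
leaves `x` into the tile `x'`, above whose apex it has the height `t'`. The three cases are the exit
through the second leg, through the first leg, and through the base; in the last case the new apex
is the reflection of the old one in the midpoint of the base, which accounts for the change of `t`.
-/
def Step (x : X) (t : ℝ) (x' : X) (t' : ℝ) : Prop :=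
  (x' = F.next x ∧ t' = t ∧ F.height x' < t ∧ t < 0) ∨
  (x = F.next x' ∧ t' = t ∧ 0 < t ∧ t < F.height x) ∨
  (x' = F.inv x ∧ t' = t - F.height x - F.height (F.next x) ∧
    F.height x < t ∧ t < F.height (F.next x))

/-- A closed horizontal leaf, as the sequence of tiles it crosses and of its heights above their
apices, with a period `n` that need not be minimal. -/
structure ClosedLeaf (n : ℕ) where
  tile : ℤ → X
  pos : ℤ → ℝ
  step : ∀ i, F.Step (tile i) (pos i) (tile (i + 1)) (pos (i + 1))
  tile_add : ∀ i, tile (i + n) = tile i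
  pos_add : ∀ i, pos (i + n) = pos i

variable {F}

/-- The half-turn `inv` carries lines moving to the right to lines moving to the left, so it
exchanges the tiles before and after a step. -/
theorem Step.reverse {x x' : X} {t t' : ℝ} (h : F.Step x t x' t') :
    F.Step (F.inv x') (-t') (F.inv x) (-t) := by
  rcases h with ⟨rfl, rfl, h1, h2⟩ | ⟨rfl, rfl, h1, h2⟩ | ⟨rfl, rfl, h1, h2⟩
  · refine Or.inr (Or.inl ⟨F.inv_next x, rfl, by linarith, ?_⟩)
    rw [F.height_inv]; linarith
  · refine Or.inl ⟨F.inv_next x', rfl, ?_, by linarith⟩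
    rw [F.height_inv]; linarith
  · refine Or.inr (Or.inr ⟨by rw [F.inv_inv], ?_, ?_, ?_⟩) <;>
      rw [F.inv_inv] <;> linarith

variable {n : ℕ} (γ : F.ClosedLeaf n)

namespace ClosedLeaf

/-- The same leaf with its index origin moved to `r`. -/
def shift (r : ℤ) : F.ClosedLeaf n where
  tile i := γ.tile (r + i)
  pos i := γ.pos (r + i)
  step i := by rw [← add_assoc]; exact γ.step _
  tile_add i := by rw [← add_assoc]; exact γ.tile_add _
  pos_add i := by rw [← add_assoc]; exact γ.pos_add _

/-- The image of the leaf under `inv`, traversed backwards, so that it moves to the right again; the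
index `r` is taken to `0`. -/
def reverse (r : ℤ) : F.ClosedLeaf n where
  tile i := F.inv (γ.tile (r - i))
  pos i := -γ.pos (r - i)
  step i := by
    have := (γ.step (r - (i + 1))).reverse
    rwa [show r - (i + 1) + 1 = r - i by ring] at this
  tile_add i := by
    have := γ.tile_add (r - (i + n))
    rw [show r - (i + n) + n = r - i by ring] at this
    rw [this]
  pos_add i := by
    have := γ.pos_add (r - (i + n))
    rw [show r - (i + n) + n = r - i by ring] at this
    rw [this]

open Classical in
/-- The indicator of the indices at which the leaf crosses the tile `x` at a height in `I`. -/
def ind (x : X) (I : Set ℝ) (i : ℤ) : ℤ := if γ.tile i = x ∧ γ.pos i ∈ I then 1 else 0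

/-- The number of times, in one period, that the leaf crosses the tile `x` at a height in `I`. -/
def count (x : X) (I : Set ℝ) : ℤ := ∑ j ∈ Finset.range n, γ.ind x I j

theorem ind_periodic (x : X) (I : Set ℝ) : Function.Periodic (γ.ind x I) n := fun i => by
  classical exact if_congr (by rw [γ.tile_add, γ.pos_add]) rfl rfl

theorem count_eq_of_iff {x y : X} {I J : Set ℝ}
    (h : ∀ i, (γ.tile i = x ∧ γ.pos i ∈ I) ↔ (γ.tile (i + 1) = y ∧ γ.pos (i + 1) ∈ J)) :
    γ.count x I = γ.count y J := by
  rw [count, count, ← sum_range_intCast_add_one (γ.ind_periodic y J)]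
  classical exact Finset.sum_congr rfl fun j _ => if_congr (h j) rfl rfl

theorem count_union {x : X} {I J : Set ℝ} (h : Disjoint I J) :
    γ.count x (I ∪ J) = γ.count x I + γ.count x J := by
  rw [count, count, count, ← Finset.sum_add_distrib]
  refine Finset.sum_congr rfl fun j _ => ?_
  have hd : γ.pos j ∈ I → γ.pos j ∉ J := fun ha => Set.disjoint_left.1 h ha
  by_cases h1 : γ.tile j = x <;> by_cases h2 : γ.pos j ∈ I <;> by_cases h3 : γ.pos j ∈ J <;>
    simp_all [ind]

theorem count_empty (x : X) : γ.count x ∅ = 0 := by simp [count, ind]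

/-- Below the apex, a leaf in `x` at the heights of the second leg goes on to `next x`, and any leaf
in `next x` at these heights comes from `x`. -/
theorem count_next_of_neg {x : X} {I : Set ℝ} (hI : I ⊆ Set.Ioo (F.height (F.next x)) 0) :
    γ.count x I = γ.count (F.next x) I := by
  refine γ.count_eq_of_iff fun i => ⟨?_, ?_⟩
  · rintro ⟨rfl, ht⟩
    obtain ⟨h1, h2⟩ := hI ht
    rcases γ.step i with ⟨h3, h4, -, -⟩ | ⟨-, -, h5, -⟩ | ⟨-, -, -, h5⟩
    · exact ⟨h3, h4 ▸ ht⟩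
    · linarith
    · linarith
  · rintro ⟨hx, ht⟩
    obtain ⟨h1, h2⟩ := hI ht
    rcases γ.step i with ⟨h3, h4, -, -⟩ | ⟨-, h4, h5, -⟩ | ⟨h3, h4, h5, h6⟩
    · exact ⟨F.next_injective (h3.symm.trans hx), h4 ▸ ht⟩
    · linarith
    · have h7 : γ.tile i = F.next (F.inv x) := by
        rw [← F.inv_next, ← hx, h3, F.inv_inv]
      have h8 : F.height (F.next x) = - F.height (γ.tile i) := by
        rw [h7, ← F.inv_next, F.height_inv, neg_neg]
      linarith

/-- Above the apex, the leg shared by `x` and `next x` is crossed from `next x` to `x`. -/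
theorem count_next_of_pos {x : X} {I : Set ℝ} (hI : I ⊆ Set.Ioo 0 (F.height (F.next x))) :
    γ.count x I = γ.count (F.next x) I := by
  refine (γ.count_eq_of_iff fun i => ⟨?_, ?_⟩).symm
  · rintro ⟨hx, ht⟩
    obtain ⟨h1, h2⟩ := hI ht
    rcases γ.step i with ⟨-, -, -, h3⟩ | ⟨h3, h4, -, -⟩ | ⟨-, -, h3, -⟩
    · linarith
    · exact ⟨F.next_injective (h3.symm.trans hx), h4 ▸ ht⟩
    · rw [hx] at h3; linarith
  · rintro ⟨rfl, ht⟩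
    obtain ⟨h1, h2⟩ := hI ht
    rcases γ.step i with ⟨h3, h4, -, h5⟩ | ⟨h3, h4, h5, -⟩ | ⟨h3, h4, h5, h6⟩
    · linarith
    · exact ⟨h3, h4 ▸ ht⟩
    · have h8 : F.height (F.next (γ.tile (i + 1))) = - F.height (F.next (γ.tile i)) := by
        rw [h3, ← F.inv_next, F.height_inv]
      linarith

/-- If the base of `x` is on the right, the leaves in `x` at its heights go on to `inv x`. -/
theorem count_inv_of_lt {x : X} {I : Set ℝ}
    (hI : I ⊆ Set.Ioo (F.height x) (F.height (F.next x))) :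
    γ.count x I =
      γ.count (F.inv x) ((fun t => t + F.height x + F.height (F.next x)) ⁻¹' I) := by
  refine γ.count_eq_of_iff fun i => ⟨?_, ?_⟩
  · rintro ⟨rfl, ht⟩
    obtain ⟨h1, h2⟩ := hI ht
    rcases γ.step i with ⟨h3, -, h5, -⟩ | ⟨-, -, -, h5⟩ | ⟨h3, h4, -, -⟩
    · rw [h3] at h5; linarith
    · linarith
    · refine ⟨h3, ?_⟩
      rw [Set.mem_preimage, h4]
      convert ht using 1
      ring
  · rintro ⟨hx, ht⟩
    obtain ⟨h1, h2⟩ := hI ht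
    have e1 : F.height (γ.tile (i + 1)) = - F.height x := by rw [hx, F.height_inv]
    have e2 : F.height (F.next (γ.tile (i + 1))) = - F.height (F.next x) := by
      rw [hx, ← F.inv_next, F.height_inv]
    rcases γ.step i with ⟨h3, h4, h5, h6⟩ | ⟨h3, h4, h5, h6⟩ | ⟨h3, h4, h5, h6⟩
    · linarith
    · rw [h3] at h6; linarith
    · have h7 : γ.tile i = x := by rw [← F.inv_inv (γ.tile i), ← h3, hx, F.inv_inv]
      subst h7
      refine ⟨rfl, ?_⟩
      rw [Set.mem_preimage, h4] at ht
      convert ht using 1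
      ring

/-- If the base of `x` is on the left, the leaves in `x` at its heights come from `inv x`. -/
theorem count_inv_of_gt {x : X} {I : Set ℝ}
    (hI : I ⊆ Set.Ioo (F.height (F.next x)) (F.height x)) :
    γ.count x I =
      γ.count (F.inv x) ((fun t => t + F.height x + F.height (F.next x)) ⁻¹' I) := by
  have e : F.height (F.next (F.inv x)) = -F.height (F.next x) := by
    rw [← F.inv_next, F.height_inv]
  rw [γ.count_inv_of_lt (x := F.inv x), F.inv_inv, F.height_inv, e]
  · congr 1
    ext t
    simp only [Set.mem_preimage]
    ring_nf
  · intro t ht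
    have := hI ht
    simp only [Set.mem_Ioo] at this
    rw [F.height_inv, e]
    constructor <;> linarith

/-- The signed number of crossings of the tile `x` at heights in `I`: those by the leaf minus those
by its reversed image under `inv`. -/
def signedCount (x : X) (I : Set ℝ) : ℤ := γ.count x I - γ.count (F.inv x) (-I)

theorem signedCount_union {x : X} {I J : Set ℝ} (h : Disjoint I J) :
    γ.signedCount x (I ∪ J) = γ.signedCount x I + γ.signedCount x J := by
  have h' : Disjoint (-I) (-J) := by
    rw [Set.disjoint_left] at h ⊢
    exact fun a ha => h (a := -a) ha
  rw [signedCount, signedCount, signedCount, Set.union_neg, γ.count_union h, γ.count_union h']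
  ring

theorem signedCount_empty (x : X) : γ.signedCount x ∅ = 0 := by
  simp [signedCount, count_empty]

theorem signedCount_next {x : X} {I : Set ℝ} (hI : I ⊆ Set.Ioo (F.height (F.next x)) 0 ∨
    I ⊆ Set.Ioo 0 (F.height (F.next x))) :
    γ.signedCount x I = γ.signedCount (F.next x) I := by
  have e : F.height (F.next (F.inv x)) = -F.height (F.next x) := by
    rw [← F.inv_next, F.height_inv]
  rw [signedCount, signedCount, F.inv_next]
  rcases hI with hI | hI
  · rw [γ.count_next_of_neg hI, γ.count_next_of_pos (x := F.inv x)]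
    intro t ht
    have := hI ht
    simp only [Set.mem_Ioo] at this ⊢
    rw [e]; constructor <;> linarith
  · rw [γ.count_next_of_pos hI, γ.count_next_of_neg (x := F.inv x)]
    intro t ht
    have := hI ht
    simp only [Set.mem_Ioo] at this ⊢
    rw [e]; constructor <;> linarith

theorem count_inv_base {x : X} {I : Set ℝ}
    (hI : I ⊆ Set.Ioo (F.height x) (F.height (F.next x)) ∨
      I ⊆ Set.Ioo (F.height (F.next x)) (F.height x)) :
    γ.count x I =
      γ.count (F.inv x) ((fun t => t + F.height x + F.height (F.next x)) ⁻¹' I) :=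
  hI.elim γ.count_inv_of_lt γ.count_inv_of_gt

theorem signedCount_inv {x : X} {I : Set ℝ}
    (hI : I ⊆ Set.Ioo (F.height x) (F.height (F.next x)) ∨
      I ⊆ Set.Ioo (F.height (F.next x)) (F.height x)) :
    γ.signedCount x I =
      γ.signedCount (F.inv x) ((fun t => t + F.height x + F.height (F.next x)) ⁻¹' I) := by
  have e : F.height (F.next (F.inv x)) = -F.height (F.next x) := by
    rw [← F.inv_next, F.height_inv]
  rw [signedCount, signedCount, γ.count_inv_base hI, γ.count_inv_base (x := F.inv x) (I := -I)]
  · congr 2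
    ext t
    simp only [Set.mem_preimage, Set.mem_neg, F.height_inv, e]
    ring_nf
  · rw [e, F.height_inv]
    refine hI.symm.imp ?_ ?_ <;>
    · intro hI t ht
      have := hI ht
      simp only [Set.mem_Ioo] at this ⊢
      constructor <;> linarith

/-- The base of a tile is carried to itself by `inv`, so leaf and reversed image cross it equally
often. -/
theorem signedCount_base (x : X) {a b : ℝ}
    (h : (a = F.height x ∧ b = F.height (F.next x)) ∨
      (a = F.height (F.next x) ∧ b = F.height x)) :
    γ.signedCount x (Set.Ioo a b) = 0 := by
  have hab : a + b = F.height x + F.height (F.next x) := by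
    rcases h with ⟨rfl, rfl⟩ | ⟨rfl, rfl⟩ <;> ring
  rw [signedCount, γ.count_inv_base (I := Set.Ioo a b), sub_eq_zero]
  · congr 1
    ext t
    simp only [Set.mem_preimage, Set.mem_neg, Set.mem_Ioo]
    constructor <;> rintro ⟨h1, h2⟩ <;> constructor <;> linarith
  · rcases h with ⟨rfl, rfl⟩ | ⟨rfl, rfl⟩ <;> simp

/-- Every leg met by the leaf has signed number of crossings `w`, when counted positively upwards
from the base vertex to the apex. A leg is named after the tile of which it is the first leg. -/
def HasFlux (w : ℤ) : Prop :=
  ∀ i, ∀ y, (y = γ.tile i ∨ y = F.next (γ.tile i)) →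
    (0 < F.height y → γ.signedCount y (Set.Ioo 0 (F.height y)) = -w) ∧
    (F.height y < 0 → γ.signedCount y (Set.Ioo (F.height y) 0) = w)

end ClosedLeaf

/-- `(lo, hi)` is the interval of heights of an oriented side of the tile `x`, and `vlo`, `vhi` are
the values at its ends of the potential that is `w` at the apex and `0` at the base vertices. -/
def IsEdge (F : FanSurface X) (w : ℤ) (x : X) (lo : ℝ) (vlo : ℤ) (hi : ℝ) (vhi : ℤ) : Prop :=
  (lo = 0 ∧ vlo = w ∧ hi = F.height x ∧ vhi = 0) ∨
  (lo = F.height x ∧ vlo = 0 ∧ hi = 0 ∧ vhi = w) ∨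
  (lo = 0 ∧ vlo = w ∧ hi = F.height (F.next x) ∧ vhi = 0) ∨
  (lo = F.height (F.next x) ∧ vlo = 0 ∧ hi = 0 ∧ vhi = w) ∨
  (lo = F.height x ∧ vlo = 0 ∧ hi = F.height (F.next x) ∧ vhi = 0) ∨
  (lo = F.height (F.next x) ∧ vlo = 0 ∧ hi = F.height x ∧ vhi = 0)

/-- Any two sides of a triangle have a vertex in common. So if the heights of two of them overlap,
they agree at the lower or at the upper end. -/
theorem IsEdge.share {w : ℤ} {x : X} {lo hi lo' hi' : ℝ} {v v' u u' : ℤ}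
    (h : F.IsEdge w x lo v hi u) (h' : F.IsEdge w x lo' v' hi' u') :
    (lo = lo' ∧ v = v') ∨ (hi = hi' ∧ u = u') ∨ hi ≤ lo' ∨ hi' ≤ lo := by
  rcases h with ⟨rfl, rfl, rfl, rfl⟩ | ⟨rfl, rfl, rfl, rfl⟩ | ⟨rfl, rfl, rfl, rfl⟩ |
    ⟨rfl, rfl, rfl, rfl⟩ | ⟨rfl, rfl, rfl, rfl⟩ | ⟨rfl, rfl, rfl, rfl⟩ <;>
  rcases h' with ⟨rfl, rfl, rfl, rfl⟩ | ⟨rfl, rfl, rfl, rfl⟩ | ⟨rfl, rfl, rfl, rfl⟩ |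
    ⟨rfl, rfl, rfl, rfl⟩ | ⟨rfl, rfl, rfl, rfl⟩ | ⟨rfl, rfl, rfl, rfl⟩ <;> simp

namespace ClosedLeaf
variable {γ} {w : ℤ}

/-- The signed number of crossings of a side is the difference of the potential at its ends. -/
theorem HasFlux.signedCount_edge (hw : γ.HasFlux w) (i : ℤ) {lo hi : ℝ} {v u : ℤ}
    (h : F.IsEdge w (γ.tile i) lo v hi u) (hlt : lo < hi) :
    γ.signedCount (γ.tile i) (Set.Ioo lo hi) = u - v := by
  have hx := hw i _ (Or.inl rfl)
  have hy := hw i _ (Or.inr rfl)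
  rcases h with ⟨rfl, rfl, rfl, rfl⟩ | ⟨rfl, rfl, rfl, rfl⟩ | ⟨rfl, rfl, rfl, rfl⟩ |
    ⟨rfl, rfl, rfl, rfl⟩ | ⟨rfl, rfl, rfl, rfl⟩ | ⟨rfl, rfl, rfl, rfl⟩
  · rw [hx.1 hlt]; ring
  · rw [hx.2 hlt]; ring
  · rw [γ.signedCount_next (Or.inr subset_rfl), hy.1 hlt]; ring
  · rw [γ.signedCount_next (Or.inl subset_rfl), hy.2 hlt]; ring
  · rw [γ.signedCount_base _ (Or.inl ⟨rfl, rfl⟩)]; ring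
  · rw [γ.signedCount_base _ (Or.inr ⟨rfl, rfl⟩)]; ring

theorem signedCount_Ioo_eq_Ioc_add_Ioo {x : X} {lo hi y : ℝ} (h1 : lo ≤ y) (h2 : y < hi) :
    γ.signedCount x (Set.Ioo lo hi) =
      γ.signedCount x (Set.Ioc lo y) + γ.signedCount x (Set.Ioo y hi) := by
  rw [← γ.signedCount_union, Set.Ioc_union_Ioo_eq_Ioo h1 h2]
  exact Set.disjoint_left.2 fun a h h' => absurd h.2 (not_le.2 h'.1)

theorem signedCount_Ioo_eq_Ioo_add_Ico {x : X} {lo hi y : ℝ} (h1 : lo < y) (h2 : y ≤ hi) :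
    γ.signedCount x (Set.Ioo lo hi) =
      γ.signedCount x (Set.Ioo lo y) + γ.signedCount x (Set.Ico y hi) := by
  rw [← γ.signedCount_union, Set.Ioo_union_Ico_eq_Ioo h1 h2]
  exact Set.disjoint_left.2 fun a h h' => absurd h.2 (not_lt.2 h'.1)

/-- The potential at height `y`, just above a possible crossing at `y`, does not depend on the side
along which it is computed. -/
theorem HasFlux.potential_right_eq (hw : γ.HasFlux w) (i : ℤ) {lo hi lo' hi' y : ℝ}
    {v v' u u' : ℤ} (h : F.IsEdge w (γ.tile i) lo v hi u) (h' : F.IsEdge w (γ.tile i) lo' v' hi' u')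
    (h1 : lo ≤ y) (h2 : y < hi) (h1' : lo' ≤ y) (h2' : y < hi') :
    v + γ.signedCount (γ.tile i) (Set.Ioc lo y) =
      v' + γ.signedCount (γ.tile i) (Set.Ioc lo' y) := by
  rcases h.share h' with ⟨rfl, rfl⟩ | ⟨rfl, rfl⟩ | h3 | h3
  · rfl
  · have e := hw.signedCount_edge i h (h1.trans_lt h2)
    have e' := hw.signedCount_edge i h' (h1'.trans_lt h2')
    rw [signedCount_Ioo_eq_Ioc_add_Ioo h1 h2] at e
    rw [signedCount_Ioo_eq_Ioc_add_Ioo h1' h2'] at e'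
    linarith
  · linarith
  · linarith

/-- The potential at height `y`, just below a possible crossing at `y`, does not depend on the side
along which it is computed. -/
theorem HasFlux.potential_left_eq (hw : γ.HasFlux w) (i : ℤ) {lo hi lo' hi' y : ℝ}
    {v v' u u' : ℤ} (h : F.IsEdge w (γ.tile i) lo v hi u) (h' : F.IsEdge w (γ.tile i) lo' v' hi' u')
    (h1 : lo < y) (h2 : y ≤ hi) (h1' : lo' < y) (h2' : y ≤ hi') :
    v + γ.signedCount (γ.tile i) (Set.Ioo lo y) =
      v' + γ.signedCount (γ.tile i) (Set.Ioo lo' y) := by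
  rcases h.share h' with ⟨rfl, rfl⟩ | ⟨rfl, rfl⟩ | h3 | h3
  · rfl
  · have e := hw.signedCount_edge i h (h1.trans_le h2)
    have e' := hw.signedCount_edge i h' (h1'.trans_le h2')
    rw [signedCount_Ioo_eq_Ioo_add_Ico h1 h2] at e
    rw [signedCount_Ioo_eq_Ioo_add_Ico h1' h2'] at e'
    linarith
  · linarith
  · linarith

variable (γ) in
/-- The side through which a leaf leaves a tile is also a side of the next tile, with the heights
translated; crossings of it may be counted on either side; and every leaf that meets it makes the
same step. -/
theorem exists_exit_edge (w : ℤ) (i : ℤ) : ∃ (lo hi : ℝ) (v u : ℤ),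
    lo < γ.pos i ∧ γ.pos i < hi ∧ F.IsEdge w (γ.tile i) lo v hi u ∧
    F.IsEdge w (γ.tile (i + 1)) (lo + (γ.pos (i + 1) - γ.pos i)) v
      (hi + (γ.pos (i + 1) - γ.pos i)) u ∧
    (∀ I ⊆ Set.Ioo lo hi, γ.signedCount (γ.tile i) I =
      γ.signedCount (γ.tile (i + 1)) ((fun t => t - (γ.pos (i + 1) - γ.pos i)) ⁻¹' I)) ∧
    ∀ t ∈ Set.Ioo lo hi, ∀ x' t', F.Step (γ.tile i) t x' t' →
      x' = γ.tile (i + 1) ∧ t' - t = γ.pos (i + 1) - γ.pos i := by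
  rcases γ.step i with ⟨h1, h2, h3, h4⟩ | ⟨h1, h2, h3, h4⟩ | ⟨h1, h2, h3, h4⟩
  · refine ⟨F.height (F.next (γ.tile i)), 0, 0, w, h1 ▸ h3, h4, by simp [IsEdge], ?_, ?_, ?_⟩
    · simp [IsEdge, h1, h2]
    · intro I hI
      rw [γ.signedCount_next (Or.inl hI), h1, h2]
      simp
    · rintro t ⟨ht1, ht2⟩ x' t' (⟨h5, h6, -, -⟩ | ⟨-, -, h5, -⟩ | ⟨-, -, -, h5⟩)
      · exact ⟨h5.trans h1.symm, by rw [h2, h6]; ring⟩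
      · linarith
      · linarith
  · refine ⟨0, F.height (γ.tile i), w, 0, h3, h4, by simp [IsEdge], ?_, ?_, ?_⟩
    · simp [IsEdge, h1, h2]
    · intro I hI
      have e := γ.signedCount_next (x := γ.tile (i + 1)) (I := I) (Or.inr (by rwa [← h1]))
      rw [← h1] at e
      rw [← e, h2]
      simp
    · rintro t ⟨ht1, ht2⟩ x' t' (⟨-, -, -, h5⟩ | ⟨h5, h6, -, -⟩ | ⟨-, -, h5, -⟩)
      · linarith
      · exact ⟨F.next_injective (h5.symm.trans h1), by rw [h2, h6]; ring⟩
      · linarith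
  · have e1 : F.height (γ.tile (i + 1)) = - F.height (γ.tile i) := by rw [h1, F.height_inv]
    have e2 : F.height (F.next (γ.tile (i + 1))) = - F.height (F.next (γ.tile i)) := by
      rw [h1, ← F.inv_next, F.height_inv]
    refine ⟨F.height (γ.tile i), F.height (F.next (γ.tile i)), 0, 0, h3, h4,
      by simp [IsEdge], ?_, ?_, ?_⟩
    · refine Or.inr <| Or.inr <| Or.inr <| Or.inr <| Or.inr ⟨?_, rfl, ?_, rfl⟩ <;> linarith
    · intro I hI
      rw [γ.signedCount_inv (Or.inl hI), h1, h2]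
      congr 1
      ext t
      simp only [Set.mem_preimage]
      ring_nf
    · rintro t ⟨ht1, ht2⟩ x' t' (⟨h5, -, h6, -⟩ | ⟨-, -, -, h5⟩ | ⟨h5, h6, -, -⟩)
      · rw [h5] at h6; linarith
      · linarith
      · exact ⟨h5.trans h1.symm, by rw [h2, h6]; ring⟩

end ClosedLeaf
end FanSurface

/-! ### The cylinder around a closed leaf -/

namespace FanSurface
variable {X : Type*} {F : FanSurface X}

theorem IsEdge.values {w : ℤ} {x : X} {lo hi : ℝ} {v u : ℤ} (h : F.IsEdge w x lo v hi u) :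
    (v = 0 ∨ v = w) ∧ (u = 0 ∨ u = w) := by
  rcases h with ⟨-, rfl, -, rfl⟩ | ⟨-, rfl, -, rfl⟩ | ⟨-, rfl, -, rfl⟩ |
    ⟨-, rfl, -, rfl⟩ | ⟨-, rfl, -, rfl⟩ | ⟨-, rfl, -, rfl⟩ <;> simp

namespace ClosedLeaf
variable {n : ℕ} {γ : F.ClosedLeaf n} {w : ℤ}

/-- A closed leaf lies in a cylinder of parallel closed leaves, of heights relative to it in an
interval `(a, b)`; a leaf through the cylinder at one place follows `γ` forever. Both boundaries of
the maximal cylinder pass through vertices, where the potential is `0` or `w`, whence the signed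
number of crossings. -/
theorem HasFlux.exists_cylinder (hw : γ.HasFlux w) (hn : 0 < n) : ∃ a b : ℝ, a < 0 ∧ 0 < b ∧
    γ.signedCount (γ.tile 0) (Set.Ioo (γ.pos 0 + a) (γ.pos 0 + b)) ∈ ({0, w, -w} : Set ℤ) ∧
    ∀ γ' : F.ClosedLeaf n, γ'.tile 0 = γ.tile 0 → γ'.pos 0 - γ.pos 0 ∈ Set.Ioo a b →
      ∀ i, γ'.tile i = γ.tile i ∧ γ'.pos i - γ.pos i = γ'.pos 0 - γ.pos 0 := by
  -- The cylinder is bounded by the first vertices met when the leaf is moved down or up, at an end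
  -- of the exit side of the tiles `i₁` and `i₂`.
  choose lo hi v u hlo hhi hE hE' hT hD using γ.exists_exit_edge w
  have hne : (Finset.range n).Nonempty := ⟨0, Finset.mem_range.2 hn⟩
  obtain ⟨i₁, hi₁, hmax⟩ := Finset.exists_max_image _ (fun i : ℕ => lo i - γ.pos i) hne
  obtain ⟨i₂, hi₂, hmin⟩ := Finset.exists_min_image _ (fun i : ℕ => hi i - γ.pos i) hne
  obtain ⟨a, ha⟩ : ∃ a, a = lo i₁ - γ.pos i₁ := ⟨_, rfl⟩
  obtain ⟨b, hb⟩ : ∃ b, b = hi i₂ - γ.pos i₂ := ⟨_, rfl⟩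
  rw [Finset.mem_range] at hi₁ hi₂
  simp only [Finset.mem_range, ← ha, ← hb] at hmax hmin
  have ha0 : a < 0 := by linarith [hlo i₁]
  have hb0 : 0 < b := by linarith [hhi i₂]
  -- The potential just above the lower boundary of the cylinder is constant.
  have right : ∀ i : ℕ, i < n →
      v i + γ.signedCount (γ.tile i) (Set.Ioc (lo i) (γ.pos i + a)) =
        v 0 + γ.signedCount (γ.tile 0) (Set.Ioc (lo 0) (γ.pos 0 + a)) := by
    intro i
    induction i with
    | zero => intro _; rfl
    | succ i ih =>
      intro hi'
      have m1 := hmax i (by omega)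
      have m2 := hmax (i + 1) hi'
      rw [← ih (by omega), hT i]
      · push_cast at m2 ⊢
        have e : (fun t => t - (γ.pos (i + 1) - γ.pos i)) ⁻¹' Set.Ioc (lo i) (γ.pos i + a) =
            Set.Ioc (lo i + (γ.pos (i + 1) - γ.pos i)) (γ.pos (i + 1) + a) := by
          rw [Set.preimage_sub_const_Ioc]; congr 1; ring
        rw [e]
        refine hw.potential_right_eq (i + 1) (hE (i + 1)) (hE' i) ?_ ?_ ?_ ?_
        · linarith
        · linarith [hhi (i + 1)]
        · linarith
        · linarith [hhi i]
      · exact fun t ht => ⟨ht.1, by linarith [ht.2, hhi i]⟩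
  -- Likewise just below the upper boundary.
  have left : ∀ i : ℕ, i < n →
      v i + γ.signedCount (γ.tile i) (Set.Ioo (lo i) (γ.pos i + b)) =
        v 0 + γ.signedCount (γ.tile 0) (Set.Ioo (lo 0) (γ.pos 0 + b)) := by
    intro i
    induction i with
    | zero => intro _; rfl
    | succ i ih =>
      intro hi'
      have m1 := hmin i (by omega)
      have m2 := hmin (i + 1) hi'
      rw [← ih (by omega), hT i]
      · push_cast at m2 ⊢
        have e : (fun t => t - (γ.pos (i + 1) - γ.pos i)) ⁻¹' Set.Ioo (lo i) (γ.pos i + b) =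
            Set.Ioo (lo i + (γ.pos (i + 1) - γ.pos i)) (γ.pos (i + 1) + b) := by
          rw [Set.preimage_sub_const_Ioo]; congr 1; ring
        rw [e]
        refine hw.potential_left_eq (i + 1) (hE (i + 1)) (hE' i) ?_ ?_ ?_ ?_
        · linarith [hlo (i + 1)]
        · linarith
        · linarith [hlo i]
        · linarith
      · exact fun t ht => ⟨ht.1, by linarith [ht.2]⟩
  refine ⟨a, b, ha0, hb0, ?_, ?_⟩
  · -- The lower boundary is a vertex of tile `i₁`, the upper one a vertex of tile `i₂`.
    have r := right i₁ hi₁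
    have l := left i₂ hi₂
    rw [show γ.pos i₁ + a = lo i₁ by rw [ha]; ring, Set.Ioc_self, γ.signedCount_empty] at r
    rw [show γ.pos i₂ + b = hi i₂ by rw [hb]; ring,
      hw.signedCount_edge i₂ (hE i₂) ((hlo _).trans (hhi _))] at l
    have s := signedCount_Ioo_eq_Ioc_add_Ioo (γ := γ) (x := γ.tile 0) (lo := lo 0)
      (y := γ.pos 0 + a) (hi := γ.pos 0 + b) (by have := hmax 0 hn; push_cast at this; linarith)
      (by linarith)
    have e : γ.signedCount (γ.tile 0) (Set.Ioo (γ.pos 0 + a) (γ.pos 0 + b)) = u i₂ - v i₁ := by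
      linarith
    rw [e]
    simp only [Set.mem_insert_iff, Set.mem_singleton_iff]
    rcases (hE i₁).values.1 with h1 | h1 <;> rcases (hE i₂).values.2 with h2 | h2 <;>
      rw [h1, h2] <;> simp
  · intro γ' h0 hd
    obtain ⟨hd1, hd2⟩ := hd
    have main : ∀ i : ℕ, i < n →
        γ'.tile i = γ.tile i ∧ γ'.pos i - γ.pos i = γ'.pos 0 - γ.pos 0 := by
      intro i
      induction i with
      | zero => intro _; exact ⟨h0, rfl⟩
      | succ i ih =>
        intro hi'
        obtain ⟨e1, e2⟩ := ih (by omega)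
        have m1 := hmax i (by omega)
        have m2 := hmin i (by omega)
        have st := γ'.step i
        rw [e1] at st
        obtain ⟨e3, e4⟩ := hD i _ ⟨by linarith, by linarith⟩ _ _ st
        push_cast
        exact ⟨e3, by linarith⟩
    intro i
    have hn' : (0 : ℤ) < n := by exact_mod_cast hn
    have hm0 := Int.emod_nonneg i hn'.ne'
    have hm1 := Int.emod_lt_of_pos i hn'
    have pt : ∀ δ : F.ClosedLeaf n, δ.tile i = δ.tile (i % n) ∧ δ.pos i = δ.pos (i % n) := by
      intro δ
      have p1 : Function.Periodic δ.tile n := δ.tile_add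
      have p2 : Function.Periodic δ.pos n := δ.pos_add
      have e : i % n = i - (i / n) • (n : ℤ) := by
        rw [smul_eq_mul, mul_comm, eq_sub_iff_add_eq]; exact Int.emod_add_mul_ediv i n
      rw [e, p1.sub_zsmul_eq, p2.sub_zsmul_eq]
      exact ⟨rfl, rfl⟩
    obtain ⟨m, hm⟩ := Int.eq_ofNat_of_zero_le hm0
    rw [(pt γ).1, (pt γ).2, (pt γ').1, (pt γ').2, hm]
    exact main m (by omega)

open Classical in
/-- Either the leaf is its own reversed image under `inv`, or the number of its periods in `{0, …, n
- 1}` is `|w|`: the former happens when the reversed image enters the cylinder of the leaf, and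
otherwise the signed number of crossings of the cylinder is the number of passages of the leaf
itself, which is positive. -/
theorem HasFlux.exists_reverse_or_card (hw : γ.HasFlux w) (hn : 0 < n) :
    (∃ r : ℤ, ∀ i, F.inv (γ.tile (r - i)) = γ.tile i) ∨
    (((Finset.range n).filter (fun j : ℕ => ∀ i : ℤ,
      γ.tile (j + i) = γ.tile i ∧ γ.pos (j + i) = γ.pos i)).card : ℤ) = |w| := by
  obtain ⟨a, b, ha, hb, hmem, hcyl⟩ := hw.exists_cylinder hn
  by_cases h : ∃ r : ℤ, ∀ i, F.inv (γ.tile (r - i)) = γ.tile i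
  · exact Or.inl h
  right
  set I := Set.Ioo (γ.pos 0 + a) (γ.pos 0 + b) with hI
  have c2 : γ.count (F.inv (γ.tile 0)) (-I) = 0 := by
    refine Finset.sum_eq_zero fun j _ => if_neg fun hj => h ⟨j, fun i => ?_⟩
    obtain ⟨h1, h2⟩ := hj
    rw [hI, Set.mem_neg, Set.mem_Ioo] at h2
    refine (hcyl (γ.reverse j) ?_ ?_ i).1
    · simp [reverse, h1, F.inv_inv]
    · simp only [reverse, sub_zero, Set.mem_Ioo]
      constructor <;> linarith
  have key : ∀ j : ℕ, (γ.tile j = γ.tile 0 ∧ γ.pos j ∈ I) ↔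
      ∀ i : ℤ, γ.tile (j + i) = γ.tile i ∧ γ.pos (j + i) = γ.pos i := by
    refine fun j => ⟨fun ⟨h1, h2⟩ => ?_, fun h => ?_⟩
    · rw [hI, Set.mem_Ioo] at h2
      have hc := hcyl (γ.shift j) (by simp [shift, h1])
        (by simp only [shift, add_zero, Set.mem_Ioo]; constructor <;> linarith)
      simp only [shift, add_zero] at hc
      -- If the leaf returned to its cylinder at another height, it would be displaced by the same
      -- amount at each of the next returns, and `n` of these lead back to the start.
      have p2 : Function.Periodic γ.pos n := γ.pos_add
      have hm : ∀ m : ℕ, γ.pos (m * j) = γ.pos 0 + m * (γ.pos j - γ.pos 0) := by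
        intro m
        induction m with
        | zero => simp
        | succ m ih =>
          have := (hc (m * j)).2
          rw [show ((m + 1 : ℕ) : ℤ) * (j : ℤ) = j + m * j by push_cast; ring]
          push_cast
          linarith
      have h3 := hm n
      rw [mul_comm, show γ.pos ((j : ℤ) * n) = γ.pos 0 from p2.int_mul_eq j] at h3
      have hn' : (n : ℝ) ≠ 0 := by exact_mod_cast hn.ne'
      have : (n : ℝ) * (γ.pos j - γ.pos 0) = 0 := by linarith
      rcases mul_eq_zero.1 this with h4 | h4
      · exact absurd h4 hn'
      · exact fun i => ⟨(hc i).1, by linarith [(hc i).2]⟩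
    · obtain ⟨h1, h2⟩ := h 0
      rw [add_zero] at h1 h2
      exact ⟨h1, by rw [h2, hI]; exact ⟨by linarith, by linarith⟩⟩
  have c1 : γ.count (γ.tile 0) I = ((Finset.range n).filter
      (fun j : ℕ => ∀ i : ℤ, γ.tile (j + i) = γ.tile i ∧ γ.pos (j + i) = γ.pos i)).card := by
    rw [count, Finset.card_filter]
    push_cast
    refine Finset.sum_congr rfl fun j _ => ?_
    have := key j
    unfold ind
    split_ifs <;> tauto
  rw [signedCount, c1, c2, sub_zero] at hmem
  have hpos : 0 < ((Finset.range n).filter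
      (fun j : ℕ => ∀ i : ℤ, γ.tile (j + i) = γ.tile i ∧ γ.pos (j + i) = γ.pos i)).card :=
    Finset.card_pos.2 ⟨0, by simp [hn]⟩
  rcases hmem with h1 | h1 | h1
  · omega
  · rw [h1, abs_of_nonneg]; omega
  · rw [Set.mem_singleton_iff] at h1
    rw [h1, abs_of_nonpos]; omega

end ClosedLeaf
end FanSurface

/-! ### Billiard polygons and orbit tiles -/

theorem reflection_span_singleton_mul_conj (a z : ℂ) (ha : a ≠ 0) :
    (Submodule.span ℝ {a}).reflection z * conj a = a * conj z := by
  have hn : (‖a‖ : ℝ) ^ 2 = a.re ^ 2 + a.im ^ 2 := by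
    rw [Complex.sq_norm, Complex.normSq_apply]; ring
  have hin : inner ℝ a z = a.re * z.re + a.im * z.im := by
    rw [Complex.inner]; simp; ring
  obtain ⟨c, hc⟩ : ∃ c, c = inner ℝ a z / (‖a‖ : ℝ) ^ 2 := ⟨_, rfl⟩
  have hc' : c * (a.re ^ 2 + a.im ^ 2) = a.re * z.re + a.im * z.im := by
    rw [← hn, ← hin, hc, div_mul_cancel₀ _ (pow_ne_zero 2 (norm_ne_zero_iff.2 ha))]
  rw [Submodule.reflection_singleton_apply]
  simp only [RCLike.ofReal_real_eq_id, id, ← hc]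
  apply Complex.ext
  · simp
    linear_combination 2 * hc'
  · simp
    ring

theorem edgeReflection_edgeReflection (v : Fin 3 → ℂ) (i : Fin 3) (z : ℂ) :
    edgeReflection v i (edgeReflection v i z) = z :=
  Submodule.reflection_reflection _ z

theorem edgeReflection_neg (v : Fin 3 → ℂ) (i : Fin 3) (z : ℂ) :
    edgeReflection v i (-z) = -edgeReflection v i z := map_neg _ z

theorem edgeReflection_smul (v : Fin 3 → ℂ) (i : Fin 3) (r : ℝ) (z : ℂ) :
    edgeReflection v i (r • z) = r • edgeReflection v i z := map_smul _ r z

/-- A periodic billiard trajectory in the triangle with vertices `v`, with bi-infinite indices: it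
strikes the edge `e i` at `pt i`, and leaves with velocity `dir i`, for a time `dur i`. The
sequences have the period `n`, which may be a multiple of the minimal one. -/
structure BilliardPolygon (v : Fin 3 → ℂ) (n : ℕ) (e : ℤ → Fin 3) where
  pt : ℤ → ℂ
  dir : ℤ → ℂ
  dur : ℤ → ℝ
  pt_mem : ∀ i, pt i ∈ openEdge v (e i)
  dur_pos : ∀ i, 0 < dur i
  pt_succ : ∀ i, pt (i + 1) = pt i + dur i • dir i
  segment_subset : ∀ i, openSegment ℝ (pt i) (pt (i + 1)) ⊆ interior (triangleRegion v)
  dir_succ : ∀ i, dir (i + 1) = edgeReflection v (e (i + 1)) (dir i)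
  dir_ne_zero : dir 0 ≠ 0
  edge_add : ∀ i, e (i + n) = e i
  pt_add : ∀ i, pt (i + n) = pt i
  dir_add : ∀ i, dir (i + n) = dir i
  dur_add : ∀ i, dur (i + n) = dur i

namespace BilliardPolygon
variable {v : Fin 3 → ℂ} {n : ℕ} {e : ℤ → Fin 3} (B : BilliardPolygon v n e)

theorem edgeReflection_ne_zero (v : Fin 3 → ℂ) (i : Fin 3) {z : ℂ} (hz : z ≠ 0) :
    edgeReflection v i z ≠ 0 := fun h => hz <| by
  rw [← edgeReflection_edgeReflection v i z, h]
  exact map_zero _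

theorem dir_ne (i : ℤ) : B.dir i ≠ 0 := by
  induction i with
  | zero => exact B.dir_ne_zero
  | succ i ih => rw [B.dir_succ]; exact edgeReflection_ne_zero _ _ ih
  | pred i ih =>
    intro h
    have := B.dir_succ (-(i : ℤ) - 1)
    rw [sub_add_cancel, h] at this
    exact ih (this.trans (map_zero _))

/-- The same trajectory with its index origin moved to `r`. -/
def shift (r : ℤ) : BilliardPolygon v n (fun i => e (i + r)) where
  pt i := B.pt (i + r)
  dir i := B.dir (i + r)
  dur i := B.dur (i + r)
  pt_mem i := B.pt_mem _
  dur_pos i := B.dur_pos _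
  pt_succ i := by rw [add_right_comm]; exact B.pt_succ _
  segment_subset i := by rw [add_right_comm]; exact B.segment_subset _
  dir_succ i := by rw [add_right_comm]; exact B.dir_succ _
  dir_ne_zero := B.dir_ne _
  edge_add i := by rw [add_right_comm]; exact B.edge_add _
  pt_add i := by rw [add_right_comm]; exact B.pt_add _
  dir_add i := by rw [add_right_comm]; exact B.dir_add _
  dur_add i := by rw [add_right_comm]; exact B.dur_add _

theorem periodic_sub {α : Type*} {f : ℤ → α} (hf : ∀ i, f (i + n) = f i) (i : ℤ) :
    f (i - n) = f i := by rw [← hf (i - n), sub_add_cancel]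

/-- The same trajectory traversed backwards, the index `r` being taken to `0`. -/
def reverse (r : ℤ) : BilliardPolygon v n (fun i => e (r - i)) where
  pt i := B.pt (r - i)
  dir i := -B.dir (r - i - 1)
  dur i := B.dur (r - i - 1)
  pt_mem i := B.pt_mem _
  dur_pos i := B.dur_pos _
  pt_succ i := by
    have := B.pt_succ (r - i - 1)
    rw [sub_add_cancel] at this
    rw [this, ← sub_sub]
    simp
  segment_subset i := by
    have := B.segment_subset (r - i - 1)
    rw [sub_add_cancel, openSegment_symm] at this
    rwa [← sub_sub]
  dir_succ i := by
    have := B.dir_succ (r - i - 1 - 1)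
    rw [sub_add_cancel] at this
    rw [this, ← sub_sub, edgeReflection_neg, edgeReflection_edgeReflection]
  dir_ne_zero := neg_ne_zero.2 (B.dir_ne _)
  edge_add i := by rw [← sub_sub]; exact periodic_sub B.edge_add _
  pt_add i := by rw [← sub_sub]; exact periodic_sub B.pt_add _
  dir_add i := by rw [← sub_sub, sub_right_comm]; rw [periodic_sub B.dir_add]
  dur_add i := by rw [← sub_sub, sub_right_comm]; rw [periodic_sub B.dur_add]

/-- The same trajectory traversed twice. -/
def double : BilliardPolygon v (n + n) e :=
  { B with
    edge_add := fun i => by push_cast; rw [← add_assoc, B.edge_add, B.edge_add]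
    pt_add := fun i => by push_cast; rw [← add_assoc, B.pt_add, B.pt_add]
    dir_add := fun i => by push_cast; rw [← add_assoc, B.dir_add, B.dir_add]
    dur_add := fun i => by push_cast; rw [← add_assoc, B.dur_add, B.dur_add] }

end BilliardPolygon

/-- The bi-infinite sequence of period `n` that continues `g 0, …, g (n - 1)`. -/
def periodize {α : Type*} (n : ℕ) (g : ℕ → α) (i : ℤ) : α := g (i % n).toNat

section periodize
variable {α : Type*} {n : ℕ}

theorem periodize_add (g : ℕ → α) (i : ℤ) : periodize n g (i + n) = periodize n g i := by
  simp [periodize]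

theorem periodize_add_one (hn : 0 < n) {g : ℕ → α} (hg : g n = g 0) (i : ℤ) :
    periodize n g (i + 1) = g ((i % n).toNat + 1) := by
  have h0 : (0 : ℤ) < n := by exact_mod_cast hn
  have h1 := Int.emod_nonneg i h0.ne'
  have h2 := Int.emod_lt_of_pos i h0
  have h3 : (i + 1) % n = (i % n + 1) % n := by simp
  rcases lt_or_eq_of_le (Int.add_one_le_iff.2 h2) with h | h
  · rw [periodize, h3, Int.emod_eq_of_lt (by omega) h]
    congr 1
    omega
  · rw [periodize, h3, h, Int.emod_self, show (i % n).toNat + 1 = n by omega, hg]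
    rfl

theorem periodize_natCast (g : ℕ → α) {i : ℕ} (hi : i < n) : periodize n g i = g i := by
  have : ((i : ℤ) % n) = i := Int.emod_eq_of_lt (by omega) (by omega)
  simp [periodize, this]

theorem toNat_emod_lt (hn : 0 < n) (i : ℤ) : (i % n).toNat < n := by
  have h0 : (0 : ℤ) < n := by exact_mod_cast hn
  have h1 := Int.emod_nonneg i h0.ne'
  have h2 := Int.emod_lt_of_pos i h0
  omega

theorem eq_periodize (hn : 0 < n) {g : ℤ → α} (hg : ∀ i, g (i + n) = g i) :
    g = periodize n (fun i => g i) := by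
  funext i
  have h0 : (0 : ℤ) < n := by exact_mod_cast hn
  have p : Function.Periodic g n := hg
  have e : i % n = i - (i / n) • (n : ℤ) := by
    rw [smul_eq_mul, mul_comm, eq_sub_iff_add_eq]; exact Int.emod_add_mul_ediv i n
  simp only [periodize]
  rw [Int.toNat_of_nonneg (Int.emod_nonneg i h0.ne'), e, p.sub_zsmul_eq]

end periodize

namespace PeriodicTrajectory
variable {v : Fin 3 → ℂ} (f : PeriodicTrajectory v)

theorem n_pos : 0 < f.n := by
  rcases Nat.eq_zero_or_pos f.n with h | h
  · have := f.time_last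
    rw [h, f.time_zero] at this
    norm_num at this
  · exact h

/-- The bi-infinite periodic continuation of a periodic trajectory. -/
def toBilliardPolygon : BilliardPolygon v f.n (periodize f.n f.edge) where
  pt := periodize f.n (fun i => f.path (f.time i))
  dir := periodize f.n f.velocity
  dur := periodize f.n (fun i => f.time (i + 1) - f.time i)
  pt_mem i := f.path_time _ (toNat_emod_lt f.n_pos i).le
  dur_pos i := sub_pos.2 (f.time_lt _ (toNat_emod_lt f.n_pos i))
  pt_succ i := by
    rw [periodize_add_one f.n_pos (by rw [f.time_last, f.time_zero, f.path_closed])]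
    have hlt := toNat_emod_lt f.n_pos i
    exact f.path_eq _ hlt _ (Set.right_mem_Icc.2 (f.time_lt _ hlt).le)
  segment_subset i := by
    rw [periodize_add_one f.n_pos (by rw [f.time_last, f.time_zero, f.path_closed])]
    have hlt := toNat_emod_lt f.n_pos i
    have ht := f.time_lt _ hlt
    rw [periodize]
    rintro z ⟨a, b, ha, hb, hab, rfl⟩
    have hm : f.time (i % f.n).toNat + b * (f.time ((i % f.n).toNat + 1) - f.time (i % f.n).toNat) ∈
        Set.Ioo (f.time (i % f.n).toNat) (f.time ((i % f.n).toNat + 1)) := by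
      have ea : a = 1 - b := by linarith
      constructor
      · nlinarith
      · nlinarith
    have h1 := f.path_interior _ hlt _ hm
    rw [f.path_eq _ hlt _ (Set.Ioo_subset_Icc_self hm)] at h1
    rw [f.path_eq _ hlt _ (Set.right_mem_Icc.2 ht.le)]
    convert h1 using 1
    rw [show a = 1 - b by linarith]
    module
  dir_succ i := by
    rw [periodize_add_one f.n_pos f.velocity_closed, periodize_add_one f.n_pos f.edge_closed]
    exact f.velocity_succ _ (toNat_emod_lt f.n_pos i)
  dir_ne_zero := by simpa [periodize] using f.velocity_ne_zero
  edge_add := periodize_add _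
  pt_add := periodize_add _
  dir_add := periodize_add _
  dur_add := periodize_add _

end PeriodicTrajectory

namespace BilliardPolygon
variable {v : Fin 3 → ℂ} {n : ℕ} {e : ℤ → Fin 3} (B : BilliardPolygon v n e)

/-- The duration of `n` segments. -/
def total : ℝ := ∑ j ∈ Finset.range n, B.dur j

/-- The time of the strike `i`, with the whole trajectory rescaled to the time interval `[0, 1]`. -/
def hitTime (i : ℕ) : ℝ := (∑ j ∈ Finset.range i, B.dur j) / B.total

/-- The path of a billiard polygon on the time interval `[0, 1]`. The summand `j` is the part of
segment `j` that is traversed before the time `s`. -/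
def trajectoryPath (s : ℝ) : ℂ :=
  B.pt 0 + ∑ j ∈ Finset.range n,
    (max 0 (min (s - B.hitTime j) (B.dur j / B.total))) • (B.total • B.dir j)

theorem total_pos (hn : 0 < n) : 0 < B.total :=
  Finset.sum_pos (fun j _ => B.dur_pos j) ⟨0, Finset.mem_range.2 hn⟩

theorem hitTime_succ (i : ℕ) : B.hitTime (i + 1) = B.hitTime i + B.dur i / B.total := by
  rw [hitTime, Finset.sum_range_succ, add_div]; rfl

theorem hitTime_lt (hn : 0 < n) (i : ℕ) : B.hitTime i < B.hitTime (i + 1) := by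
  rw [hitTime_succ]
  have := div_pos (B.dur_pos i) (B.total_pos hn)
  linarith

theorem hitTime_mono (hn : 0 < n) : Monotone B.hitTime :=
  monotone_nat_of_le_succ fun i => (B.hitTime_lt hn i).le

theorem pt_succ' (hn : 0 < n) (i : ℤ) :
    B.pt (i + 1) = B.pt i + (B.dur i / B.total) • (B.total • B.dir i) := by
  rw [B.pt_succ, smul_smul, div_mul_cancel₀ _ (B.total_pos hn).ne']

theorem trajectoryPath_eq (hn : 0 < n) {i : ℕ} (hi : i < n) {s : ℝ}
    (hs : s ∈ Set.Icc (B.hitTime i) (B.hitTime (i + 1))) :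
    B.trajectoryPath s = B.pt i + (s - B.hitTime i) • (B.total • B.dir i) := by
  have hpt : ∀ i : ℕ, B.pt i = B.pt 0 +
      ∑ j ∈ Finset.range i, (B.dur j / B.total) • (B.total • B.dir j) := by
    intro i
    induction i with
    | zero => simp
    | succ i ih =>
      rw [Finset.sum_range_succ, ← add_assoc, ← ih]
      push_cast
      exact B.pt_succ' hn i
  have hsum : ∀ m, i + 1 ≤ m → ∑ j ∈ Finset.range m,
      (max 0 (min (s - B.hitTime j) (B.dur j / B.total))) • (B.total • B.dir j) =
      ∑ j ∈ Finset.range i, (B.dur j / B.total) • (B.total • B.dir j) +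
        (s - B.hitTime i) • (B.total • B.dir i) := by
    intro m hm
    induction m, hm using Nat.le_induction with
    | base =>
      rw [Finset.sum_range_succ]
      congr 1
      · refine Finset.sum_congr rfl fun j hj => ?_
        have h1 := B.hitTime_mono hn (Nat.succ_le_iff.2 (Finset.mem_range.1 hj))
        have h2 := B.hitTime_succ j
        rw [Nat.succ_eq_add_one] at h1
        rw [min_eq_right (by linarith [hs.1]),
          max_eq_right (div_pos (B.dur_pos j) (B.total_pos hn)).le]
      · have h2 := B.hitTime_succ i
        rw [min_eq_left (by linarith [hs.2]), max_eq_right (by linarith [hs.1])]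
    | succ m hm ih =>
      have h1 := B.hitTime_mono hn hm
      rw [Finset.sum_range_succ, ih, max_eq_left, zero_smul, add_zero]
      exact (min_le_left _ _).trans (by linarith [hs.2])
  rw [trajectoryPath, hsum n hi, hpt i, add_assoc]

theorem trajectoryPath_hitTime (hn : 0 < n) {i : ℕ} (hi : i ≤ n) :
    B.trajectoryPath (B.hitTime i) = B.pt i := by
  rcases hi.lt_or_eq with h | rfl
  · rw [B.trajectoryPath_eq hn h (Set.left_mem_Icc.2 (B.hitTime_lt hn i).le)]
    simp
  · obtain ⟨m, rfl⟩ : ∃ m, i = m + 1 := ⟨i - 1, by omega⟩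
    rw [B.trajectoryPath_eq hn (Nat.lt_succ_self m) (Set.right_mem_Icc.2 (B.hitTime_lt hn m).le)]
    push_cast
    rw [B.pt_succ' hn m, B.hitTime_succ]
    simp

/-- The periodic trajectory, on the time interval `[0, 1]`, of a billiard polygon. -/
def toPeriodicTrajectory (hn : 0 < n) : PeriodicTrajectory v where
  path := B.trajectoryPath
  n := n
  time := B.hitTime
  edge i := e i
  velocity i := B.total • B.dir i
  time_zero := by simp [hitTime]
  time_last := div_self (B.total_pos hn).ne'
  time_lt i _ := B.hitTime_lt hn i
  path_time i hi := by rw [B.trajectoryPath_hitTime hn hi]; exact B.pt_mem i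
  path_eq i hi s hs := by
    rw [B.trajectoryPath_hitTime hn hi.le]; exact B.trajectoryPath_eq hn hi hs
  path_interior i hi s hs := by
    apply B.segment_subset i
    rw [B.trajectoryPath_eq hn hi (Set.Ioo_subset_Icc_self hs), openSegment_eq_image']
    have h1 := div_pos (B.dur_pos i) (B.total_pos hn)
    have h2 := B.hitTime_succ i
    refine ⟨(s - B.hitTime i) / (B.dur i / B.total), ⟨div_pos (by linarith [hs.1]) h1, ?_⟩, ?_⟩
    · rw [div_lt_one h1]; linarith [hs.2]
    · simp only
      rw [B.pt_succ' hn i, add_sub_cancel_left, smul_smul (_ / _) (_ / _), div_mul_cancel₀ _ h1.ne']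
  velocity_succ i _ := by
    push_cast
    rw [B.dir_succ, edgeReflection_smul]
  velocity_ne_zero := smul_ne_zero (B.total_pos hn).ne' B.dir_ne_zero
  path_closed := by
    have h0 := B.trajectoryPath_hitTime hn (Nat.zero_le n)
    have h1 := B.trajectoryPath_hitTime hn le_rfl
    have e0 : B.hitTime 0 = 0 := by simp [hitTime]
    have e1 : B.hitTime n = 1 := div_self (B.total_pos hn).ne'
    rw [e0] at h0
    rw [e1] at h1
    rw [h0, h1]
    simpa using B.pt_add 0
  edge_closed := by simpa using B.edge_add 0
  velocity_closed := by simpa using congrArg (B.total • ·) (B.dir_add 0)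

end BilliardPolygon

/-- The bi-infinite sequence of labels obtained by repeating the list `C`. -/
def cyclicLabels (C : List (Fin 3)) : ℤ → Fin 3 := periodize C.length (fun i => C.getD i 0)

theorem map_range_cyclicLabels (C : List (Fin 3)) :
    (List.range C.length).map (fun i : ℕ => cyclicLabels C i) = C := by
  apply List.ext_getElem
  · simp
  · intro i h1 h2
    simp [cyclicLabels, periodize_natCast _ h2, h2]

theorem cyclicLabels_map_range {n : ℕ} (hn : 0 < n) {e : ℤ → Fin 3} (he : ∀ i, e (i + n) = e i) :
    cyclicLabels ((List.range n).map (fun i : ℕ => e i)) = e := by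
  have hl : ((List.range n).map (fun i : ℕ => e i)).length = n := by simp
  rw [cyclicLabels, hl]
  conv_rhs => rw [eq_periodize hn he]
  funext i
  have := toNat_emod_lt hn i
  simp [periodize, this]

/-- The reversal allowed in a combinatorial type makes no difference, as trajectories can be
traversed backwards. -/
theorem mem_orbitTile_iff {C : List (Fin 3)} {T : ℝ × ℝ} :
    T ∈ orbitTile C ↔ T ∈ triangleSpace ∧ 0 < C.length ∧
      Nonempty (BilliardPolygon (triangleVertex T) C.length (cyclicLabels C)) := by
  constructor
  · rintro ⟨hT, f, hf⟩
    refine ⟨hT, ?_⟩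
    have hlen : C.length = f.n := by
      rcases hf with rfl | hf
      · simp [PeriodicTrajectory.edgeSequence]
      · have := congrArg List.length hf
        simpa [PeriodicTrajectory.edgeSequence] using this.symm
    refine ⟨hlen ▸ f.n_pos, ?_⟩
    have key : ∀ e : ℤ → Fin 3, BilliardPolygon (triangleVertex T) f.n e →
        C = (List.range f.n).map (fun i : ℕ => e i) →
        Nonempty (BilliardPolygon (triangleVertex T) C.length (cyclicLabels C)) := by
      intro e B hC
      rw [hlen, hC, cyclicLabels_map_range f.n_pos B.edge_add]
      exact ⟨B⟩
    have hseq : f.edgeSequence =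
        (List.range f.n).map (fun i : ℕ => periodize f.n f.edge i) :=
      List.map_congr_left fun i hi => (periodize_natCast _ (List.mem_range.1 hi)).symm
    rcases hf with hf | hf
    · exact key _ f.toBilliardPolygon (by rw [← hf, hseq])
    · refine key _ (f.toBilliardPolygon.reverse (f.n - 1)) ?_
      rw [← List.reverse_reverse C, ← hf, hseq]
      apply List.ext_getElem
      · simp
      · intro i h1 h2
        simp at h1
        simp only [List.getElem_reverse, List.getElem_map, List.getElem_range, List.length_map,
          List.length_range]
        congr 1
        omega
  · rintro ⟨hT, hn, ⟨B⟩⟩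
    exact ⟨hT, B.toPeriodicTrajectory hn, Or.inl (map_range_cyclicLabels C)⟩

/-! ### Coordinates in a triangle and unfolding -/

theorem forall_fin_three (P : Fin 3 → Prop) (h0 : P 0) (h1 : P 1) (h2 : P 2) : ∀ j, P j := by
  intro j; fin_cases j <;> assumption

theorem pos_of_mem_interior_of_forall_nonneg {s : Set ℂ} {c z : ℂ} {k : ℝ} (hc : c ≠ 0)
    (hs : ∀ w ∈ s, 0 ≤ (c * w).im + k) (hz : z ∈ interior s) : 0 < (c * z).im + k := by
  have hcont : Continuous fun t : ℝ => z - (t : ℂ) * (conj c * Complex.I) := by fun_prop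
  have hev : ∀ᶠ t : ℝ in nhds 0, z - (t : ℂ) * (conj c * Complex.I) ∈ s := by
    apply hcont.continuousAt.eventually_mem
    simpa using mem_interior_iff_mem_nhds.1 hz
  obtain ⟨t, ht, hts⟩ := ((hev.filter_mono nhdsWithin_le_nhds).and
    (self_mem_nhdsWithin : ∀ᶠ t : ℝ in nhdsWithin 0 (Set.Ioi 0), t ∈ Set.Ioi 0)).exists
  have h1 := hs _ ht
  have h2 : (c * (z - (t : ℂ) * (conj c * Complex.I))).im = (c * z).im - t * Complex.normSq c := by
    rw [Complex.normSq_apply]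
    simp
    ring
  have h3 : 0 < t * Complex.normSq c := mul_pos hts (Complex.normSq_pos.2 hc)
  linarith

theorem nonneg_of_mem_triangleRegion {v : Fin 3 → ℂ} {c : ℂ} {k : ℝ}
    (hv : ∀ j, 0 ≤ (c * v j).im + k) : ∀ w ∈ triangleRegion v, 0 ≤ (c * w).im + k := by
  have hconv : Convex ℝ {w : ℂ | 0 ≤ (c * w).im + k} := by
    intro x hx y hy a b ha hb hab
    simp only [Set.mem_ofPred_eq] at *
    have : (c * (a • x + b • y)).im + k = a * ((c * x).im + k) + b * ((c * y).im + k) := by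
      have : k = (a + b) * k := by rw [hab, one_mul]
      rw [this]
      simp
      ring_nf
      rw [show b = 1 - a by linarith]
      ring
    rw [this]
    positivity
  exact fun w hw => convexHull_min (by rintro _ ⟨j, rfl⟩; exact hv j) hconv hw

/-- Barycentric coordinates of an interior point are positive; `v 2` is taken as the origin. -/
theorem exists_coordinates_of_mem_interior {v : Fin 3 → ℂ}
    (hv : 0 < (conj (v 0 - v 2) * (v 1 - v 2)).im) {z : ℂ} (hz : z ∈ interior (triangleRegion v)) :
    ∃ a b : ℝ, 0 < a ∧ 0 < b ∧ a + b < 1 ∧ z - v 2 = a • (v 0 - v 2) + b • (v 1 - v 2) := by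
  set p := v 0 - v 2 with hp
  set r := v 1 - v 2 with hr
  set D := (conj p * r).im with hD
  have hp0 : p ≠ 0 := by rintro h; simp [hD, h] at hv
  have hr0 : r ≠ 0 := by rintro h; simp [hD, h] at hv
  have hpr : r - p ≠ 0 := by
    intro h
    rw [sub_eq_zero.1 h] at hD
    rw [hD] at hv
    simp at hv
    nlinarith
  have hDe : D = p.re * r.im - p.im * r.re := by rw [hD]; simp; ring
  have e0 : v 0 = v 2 + p := by rw [hp]; ring
  have e1 : v 1 = v 2 + r := by rw [hr]; ring
  have hb := pos_of_mem_interior_of_forall_nonneg (k := -(conj p * v 2).im) (c := conj p)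
    ((map_ne_zero _).2 hp0) (nonneg_of_mem_triangleRegion (forall_fin_three _ ?_ ?_ ?_)) hz
  rotate_left
  · rw [e0]; simp; linarith
  · rw [e1]; simp; linarith
  · simp
  have ha := pos_of_mem_interior_of_forall_nonneg (k := (conj r * v 2).im) (c := -conj r)
    (neg_ne_zero.2 ((map_ne_zero _).2 hr0))
    (nonneg_of_mem_triangleRegion (forall_fin_three _ ?_ ?_ ?_)) hz
  rotate_left
  · rw [e0]; simp; linarith
  · rw [e1]; simp; linarith
  · simp
  have hab := pos_of_mem_interior_of_forall_nonneg (k := -(conj (r - p) * (v 2 + p)).im)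
    (c := conj (r - p))
    ((map_ne_zero _).2 hpr) (nonneg_of_mem_triangleRegion (forall_fin_three _ ?_ ?_ ?_)) hz
  rotate_left
  · rw [e0]; simp
  · rw [e1]; simp; linarith
  · simp; linarith
  set y := z - v 2 with hy
  have ez : z = v 2 + y := by rw [hy]; ring
  rw [ez] at ha hb hab
  simp at ha hb hab
  obtain ⟨a, hA⟩ : ∃ a, a * D = y.re * r.im - y.im * r.re :=
    ⟨_, div_mul_cancel₀ _ hv.ne'⟩
  obtain ⟨b, hB⟩ : ∃ b, b * D = p.re * y.im - p.im * y.re :=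
    ⟨_, div_mul_cancel₀ _ hv.ne'⟩
  refine ⟨a, b, pos_of_mul_pos_left (b := D) (by linarith) hv.le,
    pos_of_mul_pos_left (b := D) (by linarith) hv.le, ?_, ?_⟩
  · have : 0 < (1 - a - b) * D := by linarith
    linarith [pos_of_mul_pos_left this hv.le]
  · apply Complex.ext
    · simp
      apply mul_right_cancel₀ hv.ne'
      linear_combination y.re * hDe - p.re * hA - r.re * hB
    · simp
      apply mul_right_cancel₀ hv.ne'
      linear_combination y.im * hDe - p.im * hA - r.im * hB

/-- A horizontal ray to the right, starting inside the triangle `0, u, w`, that leaves it through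
the open side from `0` to `w`, is below the vertex `0` and above `w`. -/
theorem crossing_far_side {u w : ℂ} (h : 0 < (conj u * w).im) {a b c ρ : ℝ} (ha : 0 < a)
    (hc : 0 < c) (hc' : c < 1) (hρ : 0 < ρ) (he : c • w = a • u + b • w + ρ) :
    w.im < c * w.im ∧ c * w.im < 0 := by
  have h1 := congrArg Complex.re he
  have h2 := congrArg Complex.im he
  simp at h1 h2 h
  have h3 : ρ * (-w.im) = a * (u.re * w.im - u.im * w.re) := by
    linear_combination w.im * h1 - w.re * h2
  have h4 : 0 < ρ * (-w.im) := by rw [h3]; apply mul_pos ha; linarith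
  have h5 : 0 < -w.im := pos_of_mul_pos_right h4 hρ.le
  constructor <;> nlinarith

/-- A horizontal ray to the right, starting inside the triangle `0, u, w`, that leaves it through
the open side from `0` to `u`, is above the vertex `0` and below `u`. -/
theorem crossing_near_side {u w : ℂ} (h : 0 < (conj u * w).im) {a b c ρ : ℝ} (hb : 0 < b)
    (hc : 0 < c) (hc' : c < 1) (hρ : 0 < ρ) (he : c • u = a • u + b • w + ρ) :
    0 < c * u.im ∧ c * u.im < u.im := by
  have h1 := congrArg Complex.re he
  have h2 := congrArg Complex.im he
  simp at h1 h2 h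
  have h3 : ρ * u.im = b * (u.re * w.im - u.im * w.re) := by
    linear_combination -u.im * h1 + u.re * h2
  have h4 : 0 < ρ * u.im := by rw [h3]; apply mul_pos hb; linarith
  have h5 : 0 < u.im := pos_of_mul_pos_right h4 hρ.le
  constructor <;> nlinarith

/-- A horizontal ray to the right, starting inside the triangle `0, u, w`, that leaves it through
the open side from `u` to `w`, is above `u` and below `w`. -/
theorem crossing_base {u w : ℂ} (h : 0 < (conj u * w).im) {a b c d ρ : ℝ} (hab : a + b < 1)
    (hc : 0 < c) (hd : 0 < d) (hcd : c + d = 1) (hρ : 0 < ρ)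
    (he : c • u + d • w = a • u + b • w + ρ) :
    u.im < c * u.im + d * w.im ∧ c * u.im + d * w.im < w.im := by
  have h1 := congrArg Complex.re he
  have h2 := congrArg Complex.im he
  simp at h1 h2 h
  obtain rfl : c = 1 - d := by linarith
  have h3 : ρ * (w.im - u.im) = (1 - a - b) * (u.re * w.im - u.im * w.re) := by
    linear_combination (u.im - w.im) * h1 + (w.re - u.re) * h2
  have h4 : 0 < ρ * (w.im - u.im) := by rw [h3]; apply mul_pos <;> linarith
  have h5 : 0 < w.im - u.im := pos_of_mul_pos_right h4 hρ.le
  constructor <;> nlinarith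

theorem edgeReflection_mul_conj_edgeReflection {v : Fin 3 → ℂ} {j : Fin 3}
    (h : v (j + 2) - v (j + 1) ≠ 0) (x y : ℂ) :
    edgeReflection v j x * conj (edgeReflection v j y) = conj x * y := by
  have h' : conj (v (j + 2) - v (j + 1)) ≠ 0 := (map_ne_zero _).2 h
  have h1 : edgeReflection v j x * conj (v (j + 2) - v (j + 1)) = _ :=
    reflection_span_singleton_mul_conj _ x h
  have h2 : edgeReflection v j y * conj (v (j + 2) - v (j + 1)) = _ :=
    reflection_span_singleton_mul_conj _ y h
  have h3 := congrArg conj h2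
  simp only [map_mul, Complex.conj_conj] at h3
  apply mul_right_cancel₀ h'
  apply mul_right_cancel₀ h
  calc _ = (edgeReflection v j x * conj (v (j + 2) - v (j + 1))) *
        (conj (edgeReflection v j y) * (v (j + 2) - v (j + 1))) := by ring
    _ = _ := by rw [h1, h3]; ring

theorem edgeReflection_eq_self {v : Fin 3 → ℂ} {j : Fin 3} {x : ℂ}
    (h : x = v (j + 2) - v (j + 1) ∨ x = v (j + 1) - v (j + 2)) : edgeReflection v j x = x := by
  apply Submodule.reflection_mem_subspace_eq_self
  rw [Submodule.mem_span_singleton]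
  rcases h with rfl | rfl
  · exact ⟨1, one_smul _ _⟩
  · exact ⟨-1, by simp⟩

namespace BilliardPolygon
variable {v : Fin 3 → ℂ} {n : ℕ} {e : ℤ → Fin 3} (B : BilliardPolygon v n e)

/-- The linear part of the unfolding of the trajectory, at segment `i`: the similarity carrying the
velocity `dir i` to the positive real axis. It preserves orientation for even `i` and reverses it
for odd `i`, so that consecutive ones differ by the reflection across the edge in between. -/
def unfolded (i : ℤ) (z : ℂ) : ℂ := if Even i then conj (B.dir i) * z else B.dir i * conj z

theorem unfolded_add (i : ℤ) (z w : ℂ) :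
    B.unfolded i (z + w) = B.unfolded i z + B.unfolded i w := by
  unfold unfolded; split_ifs
  · ring
  · rw [map_add]; ring

theorem unfolded_smul (i : ℤ) (r : ℝ) (z : ℂ) : B.unfolded i (r • z) = r • B.unfolded i z := by
  unfold unfolded; split_ifs <;> simp <;> ring

theorem unfolded_neg (i : ℤ) (z : ℂ) : B.unfolded i (-z) = -B.unfolded i z := by
  unfold unfolded; split_ifs <;> simp

theorem unfolded_dir (i : ℤ) : B.unfolded i (B.dir i) = (Complex.normSq (B.dir i) : ℝ) := by
  unfold unfolded
  split_ifs
  · rw [mul_comm, Complex.mul_conj]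
  · rw [Complex.mul_conj]

theorem unfolded_succ (hv : ∀ j, v (j + 2) - v (j + 1) ≠ 0) (i : ℤ) (z : ℂ) :
    B.unfolded (i + 1) (edgeReflection v (e (i + 1)) z) = B.unfolded i z := by
  have key := edgeReflection_mul_conj_edgeReflection (hv (e (i + 1)))
  unfold unfolded
  rw [B.dir_succ]
  by_cases hi : Even i
  · rw [if_pos hi, if_neg (by rw [Int.even_add_one]; simpa using hi), key]
  · rw [if_neg hi, if_pos (by rw [Int.even_add_one]; exact hi), mul_comm, key, mul_comm]

/-- An odd number of reflections reverses the orientation, so the period of the unfolding is that of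
the trajectory traversed twice. -/
theorem unfolded_periodic (i : ℤ) (z : ℂ) : B.unfolded (i + (n + n : ℕ)) z = B.unfolded i z := by
  have h : B.dir (i + (n + n : ℕ)) = B.dir i := B.double.dir_add i
  have h' : Even (i + (n + n : ℕ)) ↔ Even i := by
    rw [Int.even_add]
    have : Even ((n + n : ℕ) : ℤ) := by push_cast; exact ⟨n, rfl⟩
    exact iff_true_right this
  simp only [unfolded, h, h']

end BilliardPolygon

/-! ### The unfolding of a trajectory in an isosceles triangle -/

/-- The direction in which the unfolding turns about the apex when an edge is struck at the end of a
segment of even index; for odd index the direction is opposite. -/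
def turn : Fin 3 → ℤ := ![1, -1, 0]

theorem turn_injective : Function.Injective turn := by decide

theorem turn_swap : ∀ j, turn (Equiv.swap 0 1 j) = -turn j := by decide

/-- The rotation by the apex angle `π - 2θ` of the isosceles triangle with base angle `θ`. -/
def apexRotation (θ : ℝ) : ℂ := -Complex.exp (-(2 * θ : ℝ) * Complex.I)

theorem apexRotation_im (θ : ℝ) : (apexRotation θ).im = sin (2 * θ) := by
  rw [apexRotation, ← Complex.ofReal_neg, Complex.neg_im, Complex.exp_ofReal_mul_I_im, sin_neg,
    neg_neg]

theorem apexRotation_eq (θ : ℝ) : apexRotation θ = ⟨-cos (2 * θ), sin (2 * θ)⟩ := by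
  apply Complex.ext
  · rw [apexRotation, ← Complex.ofReal_neg, Complex.neg_re, Complex.exp_ofReal_mul_I_re, cos_neg]
  · exact apexRotation_im θ

theorem triangleVertex_zero (T : ℝ × ℝ) : triangleVertex T 0 = 0 := rfl

theorem triangleVertex_one (T : ℝ × ℝ) : triangleVertex T 1 = ⟨sin (T.1 + T.2), 0⟩ := rfl

theorem triangleVertex_two (T : ℝ × ℝ) :
    triangleVertex T 2 = ⟨sin T.2 * cos T.1, sin T.2 * sin T.1⟩ := by
  change ((sin T.2 : ℝ) : ℂ) * Complex.exp (T.1 * Complex.I) = _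
  apply Complex.ext
  · rw [Complex.re_ofReal_mul, Complex.exp_ofReal_mul_I_re]
  · rw [Complex.im_ofReal_mul, Complex.exp_ofReal_mul_I_im]

theorem triangleVertex_sub_ne_zero {T : ℝ × ℝ} (hT : T ∈ triangleSpace) (j : Fin 3) :
    triangleVertex T (j + 2) - triangleVertex T (j + 1) ≠ 0 := by
  obtain ⟨h1, h1', h2, h2'⟩ := hT
  have hs1 : 0 < sin T.1 := sin_pos_of_pos_of_lt_pi h1 (by linarith)
  have hs2 : 0 < sin T.2 := sin_pos_of_pos_of_lt_pi h2 (by linarith)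
  have hs : 0 < sin (T.1 + T.2) := sin_pos_of_pos_of_lt_pi (by linarith) (by linarith)
  have h := mul_pos hs2 hs1
  refine forall_fin_three (fun j => triangleVertex T (j + 2) - triangleVertex T (j + 1) ≠ 0)
    (fun h0 => ?_) (fun h0 => ?_) (fun h0 => ?_) j
  · have h0' : triangleVertex T 2 - triangleVertex T 1 = 0 := h0
    rw [triangleVertex_two, triangleVertex_one] at h0'
    have := congrArg Complex.im h0'
    simp only [Complex.sub_im, Complex.zero_im] at this
    linarith
  · have h0' : triangleVertex T 0 - triangleVertex T 2 = 0 := h0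
    rw [triangleVertex_two, triangleVertex_zero] at h0'
    have := congrArg Complex.im h0'
    simp only [Complex.sub_im, Complex.zero_im] at this
    linarith
  · have h0' : triangleVertex T 1 - triangleVertex T 0 = 0 := h0
    rw [triangleVertex_one, triangleVertex_zero] at h0'
    have := congrArg Complex.re h0'
    simp only [Complex.sub_re, Complex.zero_re] at this
    linarith

section isosceles
variable (θ : ℝ)

theorem isosceles_zero_sub_two :
    triangleVertex (θ, θ) 0 - triangleVertex (θ, θ) 2 =
      ⟨-(sin θ * cos θ), -(sin θ * sin θ)⟩ := by
  rw [triangleVertex_zero, triangleVertex_two]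
  apply Complex.ext <;> simp

theorem isosceles_one_sub_two :
    triangleVertex (θ, θ) 1 - triangleVertex (θ, θ) 2 =
      ⟨sin θ * cos θ, -(sin θ * sin θ)⟩ := by
  rw [triangleVertex_one, triangleVertex_two]
  apply Complex.ext
  · simp only [Complex.sub_re, sin_add]; ring
  · simp

/-- The triangle is symmetric about the vertical through its apex. -/
theorem isosceles_conj :
    conj (triangleVertex (θ, θ) 0 - triangleVertex (θ, θ) 2) =
      -(triangleVertex (θ, θ) 1 - triangleVertex (θ, θ) 2) := by
  rw [isosceles_zero_sub_two, isosceles_one_sub_two]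
  apply Complex.ext <;> simp

theorem isosceles_rotation :
    triangleVertex (θ, θ) 1 - triangleVertex (θ, θ) 2 =
      apexRotation θ * (triangleVertex (θ, θ) 0 - triangleVertex (θ, θ) 2) := by
  rw [isosceles_zero_sub_two, isosceles_one_sub_two, apexRotation_eq, cos_two_mul, sin_two_mul]
  have := sin_sq_add_cos_sq θ
  apply Complex.ext
  · simp only [Complex.mul_re]
    linear_combination (- 2 * sin θ * cos θ) * this
  · simp only [Complex.mul_im]
    ring

theorem isosceles_edgeReflection_base (hs : sin (θ + θ) ≠ 0) (z : ℂ) :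
    edgeReflection (triangleVertex (θ, θ)) 2 z = conj z := by
  have e1 : triangleVertex (θ, θ) 1 - triangleVertex (θ, θ) 0 = (sin (θ + θ) : ℝ) := by
    rw [triangleVertex_one, triangleVertex_zero, sub_zero]; rfl
  have hne : ((sin (θ + θ) : ℝ) : ℂ) ≠ 0 := by exact_mod_cast hs
  have h := reflection_span_singleton_mul_conj
    (triangleVertex (θ, θ) 1 - triangleVertex (θ, θ) 0) z (e1 ▸ hne)
  change edgeReflection (triangleVertex (θ, θ)) 2 z * _ = _ at h
  rw [e1, Complex.conj_ofReal, mul_comm] at h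
  exact mul_left_cancel₀ hne h

end isosceles

namespace BilliardPolygon

/-- The first leg, from the apex, of the unfolded triangle at segment `i`, namely the leg from which
the other one is obtained by rotating counterclockwise by the apex angle. It is the image of the leg
to the vertex `0` or `1` according to the orientation of the unfolding. -/
def tileVector {v : Fin 3 → ℂ} {n : ℕ} {e : ℤ → Fin 3} (B : BilliardPolygon v n e) (i : ℤ) : ℂ :=
  if Even i then B.unfolded i (v 0 - v 2) else B.unfolded i (v 1 - v 2)

/-- The height, above the apex of the unfolded triangle, of the line the trajectory unfolds to. -/
def apexHeight {v : Fin 3 → ℂ} {n : ℕ} {e : ℤ → Fin 3} (B : BilliardPolygon v n e) (i : ℤ) : ℝ :=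
  (B.unfolded i (B.pt i - v 2)).im

variable {θ : ℝ} {v : Fin 3 → ℂ} {n : ℕ} {e : ℤ → Fin 3} (B : BilliardPolygon v n e)

theorem apexRotation_mul_tileVector (hv : v = triangleVertex (θ, θ)) (i : ℤ) :
    apexRotation θ * B.tileVector i =
    if Even i then B.unfolded i (v 1 - v 2)
      else B.unfolded i (v 0 - v 2) := by
  subst hv
  rw [tileVector]
  by_cases hi : Even i
  · rw [if_pos hi, if_pos hi, unfolded, unfolded, if_pos hi, if_pos hi, isosceles_rotation]
    ring
  · have h1 := isosceles_conj θ
    have h2 := congrArg conj h1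
    rw [Complex.conj_conj, map_neg] at h2
    rw [if_neg hi, if_neg hi, unfolded, unfolded, if_neg hi, if_neg hi, h1,
      ← neg_eq_iff_eq_neg.2 h2, isosceles_rotation]
    ring

theorem tileVector_ne_zero (hv : v = triangleVertex (θ, θ))
    (hT : (θ, θ) ∈ triangleSpace) (i : ℤ) : B.tileVector i ≠ 0 := by
  subst hv
  have h0 : triangleVertex (θ, θ) 0 - triangleVertex (θ, θ) 2 ≠ 0 :=
    triangleVertex_sub_ne_zero hT 1
  have h1 : triangleVertex (θ, θ) 1 - triangleVertex (θ, θ) 2 ≠ 0 := fun h =>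
    triangleVertex_sub_ne_zero hT 0 (show triangleVertex (θ, θ) 2 - triangleVertex (θ, θ) 1 = 0 by
      rw [← neg_sub, h, neg_zero])
  have hd := B.dir_ne i
  rw [tileVector, unfolded, unfolded]
  split_ifs
  · exact mul_ne_zero ((map_ne_zero _).2 hd) h0
  · exact mul_ne_zero hd ((map_ne_zero _).2 h1)

/-- In the unfolded triangle at segment `i`, the next strike is reached along a horizontal ray to
the right, starting at an interior point with the coordinates `a`, `b` with respect to the legs. -/
theorem exists_unfolded_pt_succ (hv : v = triangleVertex (θ, θ))
    (hT : (θ, θ) ∈ triangleSpace) (i : ℤ) : ∃ a b ρ : ℝ,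
    0 < a ∧ 0 < b ∧ a + b < 1 ∧ 0 < ρ ∧ B.unfolded i (B.pt (i + 1) - v 2) =
      a • B.tileVector i + b • (apexRotation θ * B.tileVector i) + (ρ : ℂ) ∧
    B.apexHeight i = (B.unfolded i (B.pt (i + 1) - v 2)).im := by
  obtain ⟨h1, h1', -, -⟩ := hT
  simp only at h1 h1'
  have hs : 0 < sin θ := sin_pos_of_pos_of_lt_pi h1 (by linarith)
  have hc : 0 < cos θ := cos_pos_of_mem_Ioo ⟨by linarith, h1'⟩
  have hor : 0 < (conj (v 0 - v 2) *
      (v 1 - v 2)).im := by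
    rw [hv, isosceles_conj, isosceles_one_sub_two]
    simp only [Complex.mul_im, Complex.neg_re, Complex.neg_im]
    have := mul_pos (mul_pos hs hc) (mul_pos hs hs)
    linarith
  have hmid : B.pt i + (B.dur i / 2) • B.dir i ∈
      interior (triangleRegion v) := by
    apply B.segment_subset i
    refine ⟨1 / 2, 1 / 2, by norm_num, by norm_num, by norm_num, ?_⟩
    rw [B.pt_succ]
    module
  obtain ⟨a, b, ha, hb, hab, h⟩ := exists_coordinates_of_mem_interior hor hmid
  have hρ : 0 < B.dur i / 2 * Complex.normSq (B.dir i) :=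
    mul_pos (half_pos (B.dur_pos i)) (Complex.normSq_pos.2 (B.dir_ne i))
  have hy : B.unfolded i (B.pt (i + 1) - v 2) =
      a • B.unfolded i (v 0 - v 2) +
      b • B.unfolded i (v 1 - v 2) +
      ((B.dur i / 2 * Complex.normSq (B.dir i) : ℝ) : ℂ) := by
    rw [← unfolded_smul, ← unfolded_smul, ← unfolded_add, ← h, Complex.ofReal_mul, ← unfolded_dir,
      ← Complex.real_smul, ← unfolded_smul, ← unfolded_add, B.pt_succ]
    congr 1
    module
  have ht : B.apexHeight i = (B.unfolded i (B.pt (i + 1) - v 2)).im := by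
    have : B.pt (i + 1) - v 2 =
        (B.pt i - v 2) + B.dur i • B.dir i := by
      rw [B.pt_succ]; ring
    rw [this, unfolded_add, unfolded_smul, unfolded_dir, apexHeight, Complex.real_smul,
      ← Complex.ofReal_mul, Complex.add_im, Complex.ofReal_im, add_zero]
  rw [B.apexRotation_mul_tileVector hv, tileVector]
  by_cases hi : Even i
  · rw [if_pos hi, if_pos hi]
    exact ⟨a, b, _, ha, hb, hab, hρ, hy, ht⟩
  · rw [if_neg hi, if_neg hi]
    exact ⟨b, a, _, hb, ha, by linarith, hρ, by rw [hy]; ring, ht⟩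

/-- The three ways in which the trajectory passes from one unfolded triangle to the next: through
the second leg, through the first leg, and through the base. -/
theorem isosceles_step (hv : v = triangleVertex (θ, θ))
    (hT : (θ, θ) ∈ triangleSpace) (i : ℤ) :
    ((i.negOnePow : ℤ) * turn (e (i + 1)) = 1 ∧
      B.tileVector (i + 1) = apexRotation θ * B.tileVector i ∧
      B.apexHeight (i + 1) = B.apexHeight i ∧
      (B.tileVector (i + 1)).im < B.apexHeight i ∧ B.apexHeight i < 0) ∨
    ((i.negOnePow : ℤ) * turn (e (i + 1)) = -1 ∧
      B.tileVector i = apexRotation θ * B.tileVector (i + 1) ∧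
      B.apexHeight (i + 1) = B.apexHeight i ∧
      0 < B.apexHeight i ∧ B.apexHeight i < (B.tileVector i).im) ∨
    ((i.negOnePow : ℤ) * turn (e (i + 1)) = 0 ∧
      B.tileVector (i + 1) = -B.tileVector i ∧
      B.apexHeight (i + 1) = B.apexHeight i - (B.tileVector i).im -
        (apexRotation θ * B.tileVector i).im ∧
      (B.tileVector i).im < B.apexHeight i ∧
      B.apexHeight i < (apexRotation θ * B.tileVector i).im) := by
  have hsin2 : 0 < sin (2 * θ) := by
    have := hT.1; have := hT.2.1; simp only at *
    exact sin_pos_of_pos_of_lt_pi (by linarith) (by linarith)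
  have hor : 0 < (conj (B.tileVector i) * (apexRotation θ * B.tileVector i)).im := by
    rw [mul_left_comm, ← Complex.normSq_eq_conj_mul_self, Complex.im_mul_ofReal, apexRotation_im]
    exact mul_pos hsin2 (Complex.normSq_pos.2 (B.tileVector_ne_zero hv hT i))
  have hsucc := B.unfolded_succ (by rw [hv]; exact triangleVertex_sub_ne_zero hT) i
  have hrr := edgeReflection_edgeReflection v (e (i + 1))
  have hmem := B.pt_mem (i + 1)
  have hu := B.apexRotation_mul_tileVector hv i
  have hu' := B.apexRotation_mul_tileVector hv (i + 1)
  have ht' : B.apexHeight (i + 1) = (B.unfolded i (edgeReflection v (e (i + 1))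
      (B.pt (i + 1) - v 2))).im := by
    rw [← hsucc, hrr, apexHeight]
  obtain ⟨a, b, ρ, ha, hb, hab, hρ, hy, ht⟩ := B.exists_unfolded_pt_succ hv hT i
  have hU : B.tileVector i =
      if Even i then B.unfolded i (v 0 - v 2) else B.unfolded i (v 1 - v 2) := rfl
  have hU' : B.tileVector (i + 1) = if Even (i + 1) then B.unfolded (i + 1) (v 0 - v 2)
      else B.unfolded (i + 1) (v 1 - v 2) := rfl
  simp only [Int.even_add_one] at hU' hu'
  have h012 : e (i + 1) = 0 ∨ e (i + 1) = 1 ∨ e (i + 1) = 2 := by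
    generalize e (i + 1) = x; revert x; decide
  rcases h012 with he | he | he
  -- The side from the apex to the vertex `1`.
  · rw [he] at hmem hsucc ht'
    obtain ⟨c, d, hc, hd, hcd, hpt⟩ := hmem
    have hpt' : B.pt (i + 1) - v 2 = c • (v 1 - v 2) := by
      rw [← hpt, show (0 : Fin 3) + 1 = 1 from rfl, show (0 : Fin 3) + 2 = 2 from rfl,
        show d = 1 - c by linarith]
      module
    have hr : edgeReflection v 0 (v 1 - v 2) = v 1 - v 2 := edgeReflection_eq_self (Or.inr rfl)
    have hs := hsucc (v 1 - v 2)
    rw [hr] at hs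
    rw [hpt', edgeReflection_smul, hr, ← hpt', ← ht] at ht'
    rw [hpt', unfolded_smul] at hy ht
    by_cases hi : Even i
    · left
      simp only [hi, if_true, not_true_eq_false, if_false] at hu hu' hU hU'
      rw [← hu] at hy ht hs
      obtain ⟨h1, h2⟩ := crossing_far_side hor ha hc (by linarith) hρ hy
      rw [hU', hs]
      rw [Complex.smul_im, smul_eq_mul] at ht
      exact ⟨by rw [he, Int.negOnePow_even i hi]; rfl, rfl, ht', by rw [ht]; exact h1,
        by rw [ht]; exact h2⟩
    · right; left
      simp only [hi, if_true, not_false_eq_true, if_false] at hu hu' hU hU'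
      rw [← hU] at hy ht hs
      obtain ⟨h1, h2⟩ := crossing_near_side hor hb hc (by linarith) hρ hy
      rw [hu', hs]
      rw [Complex.smul_im, smul_eq_mul] at ht
      exact ⟨by rw [he, Int.negOnePow_odd i (Int.not_even_iff_odd.1 hi)]; rfl, rfl, ht',
        by rw [ht]; exact h1, by rw [ht]; exact h2⟩
  -- The side from the apex to the vertex `0`.
  · rw [he] at hmem hsucc ht'
    obtain ⟨d, c, hd, hc, hcd, hpt⟩ := hmem
    have hpt' : B.pt (i + 1) - v 2 = c • (v 0 - v 2) := by
      rw [← hpt, show (1 : Fin 3) + 1 = 2 from rfl, show (1 : Fin 3) + 2 = 0 from rfl,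
        show d = 1 - c by linarith]
      module
    have hr : edgeReflection v 1 (v 0 - v 2) = v 0 - v 2 := edgeReflection_eq_self (Or.inl rfl)
    have hs := hsucc (v 0 - v 2)
    rw [hr] at hs
    rw [hpt', edgeReflection_smul, hr, ← hpt', ← ht] at ht'
    rw [hpt', unfolded_smul] at hy ht
    by_cases hi : Even i
    · right; left
      simp only [hi, if_true, not_true_eq_false, if_false] at hu hu' hU hU'
      rw [← hU] at hy ht hs
      obtain ⟨h1, h2⟩ := crossing_near_side hor hb hc (by linarith) hρ hy
      rw [hu', hs]
      rw [Complex.smul_im, smul_eq_mul] at ht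
      exact ⟨by rw [he, Int.negOnePow_even i hi]; rfl, rfl, ht', by rw [ht]; exact h1,
        by rw [ht]; exact h2⟩
    · left
      simp only [hi, if_true, not_false_eq_true, if_false] at hu hu' hU hU'
      rw [← hu] at hy ht hs
      obtain ⟨h1, h2⟩ := crossing_far_side hor ha hc (by linarith) hρ hy
      rw [hU', hs]
      rw [Complex.smul_im, smul_eq_mul] at ht
      exact ⟨by rw [he, Int.negOnePow_odd i (Int.not_even_iff_odd.1 hi)]; rfl, rfl, ht',
        by rw [ht]; exact h1, by rw [ht]; exact h2⟩
  -- The base.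
  · right; right
    rw [he] at hmem hsucc ht'
    obtain ⟨c, d, hc, hd, hcd, hpt⟩ := hmem
    have hpt' : B.pt (i + 1) - v 2 = c • (v 0 - v 2) + d • (v 1 - v 2) := by
      rw [← hpt, show (2 : Fin 3) + 1 = 0 from rfl, show (2 : Fin 3) + 2 = 1 from rfl,
        show d = 1 - c by linarith]
      module
    have hb0 : edgeReflection v 2 (v 0 - v 2) = -(v 1 - v 2) := by
      rw [hv, isosceles_edgeReflection_base θ (by rw [← two_mul]; exact hsin2.ne'),
        isosceles_conj]
    have hb1 : edgeReflection v 2 (v 1 - v 2) = -(v 0 - v 2) := by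
      rw [← edgeReflection_edgeReflection v 2 (v 0 - v 2), hb0, edgeReflection_neg, neg_neg]
    have hadd : edgeReflection v 2 (c • (v 0 - v 2) + d • (v 1 - v 2)) =
        c • edgeReflection v 2 (v 0 - v 2) + d • edgeReflection v 2 (v 1 - v 2) := by
      rw [← edgeReflection_smul, ← edgeReflection_smul]; exact map_add _ _ _
    rw [hpt', hadd, hb0, hb1, unfolded_add, unfolded_smul, unfolded_smul, unfolded_neg,
      unfolded_neg] at ht'
    rw [hpt', unfolded_add, unfolded_smul, unfolded_smul] at hy ht
    have hs0 := hsucc (v 0 - v 2)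
    have hs1 := hsucc (v 1 - v 2)
    rw [hb0, unfolded_neg] at hs0
    rw [hb1, unfolded_neg] at hs1
    by_cases hi : Even i
    · simp only [hi, if_true, not_true_eq_false, if_false] at hu hu' hU hU'
      rw [← hu, ← hU] at hy ht ht'
      obtain ⟨h1, h2⟩ := crossing_base hor hab hc hd hcd hρ hy
      simp only [Complex.add_im, Complex.smul_im, smul_eq_mul, Complex.neg_im] at ht ht'
      refine ⟨by rw [he]; simp [turn], ?_, ?_, by rw [ht]; exact h1, by rw [ht]; exact h2⟩
      · rw [hU', hU, ← hs0, neg_neg]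
      · rw [ht, ht', show d = 1 - c by linarith]; ring
    · simp only [hi, if_true, not_false_eq_true, if_false] at hu hu' hU hU'
      rw [← hu, ← hU] at hy ht ht'
      rw [add_comm] at hcd
      rw [add_comm (c • _)] at hy
      obtain ⟨h1, h2⟩ := crossing_base hor hab hd hc hcd hρ hy
      simp only [Complex.add_im, Complex.smul_im, smul_eq_mul, Complex.neg_im] at ht ht'
      rw [add_comm] at ht
      refine ⟨by rw [he]; simp [turn], ?_, ?_, by rw [ht]; exact h1, by rw [ht]; exact h2⟩
      · rw [hU', hU, ← hs1, neg_neg]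
      · rw [ht, ht', show d = 1 - c by linarith]; ring

end BilliardPolygon

/-! ### Paths through fans and the flux of their leaves -/

theorem eq_apply_zero_of_forall_add_one {α : Type*} {f : ℤ → α} (h : ∀ i, f (i + 1) = f i) (i : ℤ) :
    f i = f 0 := by
  induction i with
  | zero => rfl
  | succ i ih => rw [h, ih]
  | pred i ih => rw [← ih, ← h (-(i : ℤ) - 1), sub_add_cancel]

theorem exists_int_antidifference (m : ℤ → ℤ) :
    ∃ k : ℤ → ℤ, k 0 = 0 ∧ ∀ i, k (i + 1) = k i + m i := by
  refine ⟨fun i => ∑ j ∈ Finset.range i.toNat, m j -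
    ∑ j ∈ Finset.range (-i).toNat, m (-(j : ℤ) - 1), by simp, fun i => ?_⟩
  rcases lt_or_ge i 0 with hi | hi
  · obtain ⟨a, rfl⟩ : ∃ a : ℕ, i = -(a : ℤ) - 1 := ⟨(-i - 1).toNat, by omega⟩
    have h1 : (-(a : ℤ) - 1 + 1).toNat = 0 := by omega
    have h2 : (-(a : ℤ) - 1).toNat = 0 := by omega
    have h3 : (-(-(a : ℤ) - 1 + 1)).toNat = a := by omega
    have h4 : (-(-(a : ℤ) - 1)).toNat = a + 1 := by omega
    simp only [h1, h2, h3, h4, Finset.sum_range_succ]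
    ring
  · obtain ⟨a, rfl⟩ := Int.eq_ofNat_of_zero_le hi
    have h1 : ((a : ℤ) + 1).toNat = a + 1 := by omega
    have h2 : (-((a : ℤ) + 1)).toNat = 0 := by omega
    have h3 : (-(a : ℤ)).toNat = 0 := by omega
    simp only [h1, h2, h3, Int.toNat_natCast, Finset.sum_range_succ]
    simp

theorem ediv_sub_ediv_sub_one {N : ℤ} (hN : 0 < N) (b : ℤ) :
    b / N - (b - 1) / N = if N ∣ b then 1 else 0 := by
  have hb := Int.emod_add_mul_ediv b N
  have h0 := Int.emod_nonneg b hN.ne'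
  have h1 := Int.emod_lt_of_pos b hN
  split_ifs with h
  · obtain ⟨c, rfl⟩ := h
    rw [Int.mul_ediv_cancel_left _ hN.ne', show N * c - 1 = -1 + N * c by ring,
      Int.add_mul_ediv_left _ _ hN.ne', Int.ediv_eq_neg_one_of_neg_of_le (by omega) (by omega)]
    ring
  · have h2 : b % N ≠ 0 := fun h' => h (Int.dvd_of_emod_eq_zero h')
    have h3 : b - 1 = (b % N - 1) + N * (b / N) := by linarith
    rw [h3, Int.add_mul_ediv_left _ _ hN.ne',
      Int.ediv_eq_zero_of_lt (a := b % N - 1) (by omega) (by omega)]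
    ring

/-- A function of the level that jumps by one at the levels congruent to `κ` modulo `N`, and only
there. For `N = 0` the residue `κ` is a single integer, and `ψ` a step function. -/
theorem exists_level_potential {N : ℕ} {M w : ℤ} (hM : M = N * w) (h0 : N = 0 → w = 0)
    (κ : ZMod N) : ∃ ψ : ℤ → ℤ,
    (∀ a : ℤ, ψ (a + 1) - ψ a = if ((a + 1 : ℤ) : ZMod N) = κ then 1 else 0) ∧
    ∀ a, ψ (a + M) = ψ a + w := by
  obtain ⟨b, rfl⟩ := ZMod.intCast_surjective κ
  have key : ∀ a : ℤ, ((a : ZMod N) = (b : ZMod N)) ↔ (N : ℤ) ∣ a - b := fun a => by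
    rw [eq_comm, ZMod.intCast_eq_intCast_iff_dvd_sub]
  rcases Nat.eq_zero_or_pos N with rfl | hN
  · refine ⟨fun a => if b ≤ a then 1 else 0, fun a => ?_, fun a => ?_⟩
    · simp only [key, Nat.cast_zero, zero_dvd_iff]
      split_ifs <;> omega
    · simp [hM, h0 rfl]
  · have hN' : (0 : ℤ) < N := by exact_mod_cast hN
    refine ⟨fun a => (a - b) / N, fun a => ?_, fun a => ?_⟩
    · simp only [key]
      rw [← ediv_sub_ediv_sub_one hN', show a + 1 - b - 1 = a - b by ring]
    · simp only
      rw [hM, show a + N * w - b = (a - b) + N * w by ring, Int.add_mul_ediv_left _ _ hN'.ne']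

/-- The tiles of all directions, with a level modulo `N` that grows by one from a tile to the next
around the apex; `N = 0` stands for levels in `ℤ`. A tile is given by the vector of its first leg,
and rotation about the apex by the apex angle is multiplication by `g`. -/
def rotationSurface {g : ℂ} (hg : g ≠ 0) (N : ℕ) : FanSurface (ℂ × ZMod N) where
  next x := (g * x.1, x.2 + 1)
  inv x := (-x.1, x.2)
  height x := x.1.im
  next_injective x y h := by
    simp only [Prod.mk.injEq] at h
    exact Prod.ext (mul_left_cancel₀ hg h.1) (add_right_cancel h.2)
  inv_inv x := by simp
  inv_next x := by simp
  height_inv x := by simp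

/-- The first leg `u` of a tile changes to `u'` by a rotation by `m` tiles about the apex, with `m =
1` or `m = -1`, or, if `m = 0`, by the half-turn about the midpoint of the base. -/
def TileMove (g : ℂ) (m : ℤ) (u u' : ℂ) : Prop :=
  (m = 1 ∧ u' = g * u) ∨ (m = -1 ∧ u = g * u') ∨ (m = 0 ∧ u' = -u)

/-- Since `g` is not real, the legs before and after a step determine the kind of step. -/
theorem TileMove.unique {g : ℂ} (hg : g ≠ -1) (hg2 : g * g ≠ 1) {m m' : ℤ} {u u' : ℂ} (hu : u ≠ 0)
    (h : TileMove g m u u') (h' : TileMove g m' u u') : m = m' := by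
  have a1 : ¬ (g * u = -u) := fun h0 => hg (mul_right_cancel₀ hu (by rw [h0]; ring))
  have a2 : ¬ (u = g * (g * u)) := fun h0 => hg2 (mul_right_cancel₀ hu (by
    rw [one_mul, mul_assoc]; exact h0.symm))
  have a3 : ¬ (u = g * (-u)) := fun h0 => a1 (by
    rw [mul_neg] at h0
    rw [← neg_eq_iff_eq_neg, ← h0])
  rcases h with ⟨rfl, rfl⟩ | ⟨rfl, h⟩ | ⟨rfl, rfl⟩ <;>
    rcases h' with ⟨rfl, h'⟩ | ⟨rfl, h'⟩ | ⟨rfl, h'⟩ <;> first | rfl | (exfalso; tauto) | skip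
  · exact absurd (h'.symm ▸ h) a2
  · exact absurd (h'.symm ▸ h) a3

theorem TileMove.reverse {g : ℂ} {m : ℤ} {u u' : ℂ} (h : TileMove g m u u') :
    TileMove g (-m) (-u') (-u) := by
  rcases h with ⟨rfl, h⟩ | ⟨rfl, h⟩ | ⟨rfl, h⟩
  · exact Or.inr (Or.inl ⟨rfl, by rw [h]; ring⟩)
  · exact Or.inl ⟨rfl, by rw [h]; ring⟩
  · exact Or.inr (Or.inr ⟨rfl, by rw [h, neg_neg]⟩)

/-- A closed horizontal path through tiles with first legs `vec i`, at heights `ht i` above their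
apices. The integer `level i` counts the tiles passed counterclockwise about apices, minus those
passed clockwise, and `turns` is its increase over the period `n`. -/
structure FanPath (g : ℂ) (n : ℕ) where
  vec : ℤ → ℂ
  ht : ℤ → ℝ
  level : ℤ → ℤ
  turns : ℤ
  step : ∀ i,
    (level (i + 1) = level i + 1 ∧ vec (i + 1) = g * vec i ∧ ht (i + 1) = ht i ∧
      (vec (i + 1)).im < ht i ∧ ht i < 0) ∨
    (level (i + 1) = level i - 1 ∧ vec i = g * vec (i + 1) ∧ ht (i + 1) = ht i ∧
      0 < ht i ∧ ht i < (vec i).im) ∨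
    (level (i + 1) = level i ∧ vec (i + 1) = -vec i ∧
      ht (i + 1) = ht i - (vec i).im - (g * vec i).im ∧
      (vec i).im < ht i ∧ ht i < (g * vec i).im)
  vec_ne_zero : vec 0 ≠ 0
  level_zero : level 0 = 0
  vec_add : ∀ i, vec (i + n) = vec i
  ht_add : ∀ i, ht (i + n) = ht i
  level_add : ∀ i, level (i + n) = level i + turns

namespace FanPath
variable {g : ℂ} {n : ℕ} (p : FanPath g n)

theorem tileMove (i : ℤ) : TileMove g (p.level (i + 1) - p.level i) (p.vec i) (p.vec (i + 1)) := by
  rcases p.step i with ⟨h1, h2, -⟩ | ⟨h1, h2, -⟩ | ⟨h1, h2, -⟩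
  · exact Or.inl ⟨by rw [h1]; ring, h2⟩
  · exact Or.inr (Or.inl ⟨by rw [h1]; ring, h2⟩)
  · exact Or.inr (Or.inr ⟨by rw [h1]; ring, h2⟩)

/-- Each step multiplies the first leg by `g`, `g⁻¹` or `-1`, that is, by `-(-g) ^ m` where `m` is
the increase of the level. -/
theorem vec_eq (hg : g ≠ 0) (i : ℤ) :
    p.vec i = ((i.negOnePow : ℤ) : ℂ) * (-g) ^ p.level i * p.vec 0 := by
  have hg' : -g ≠ 0 := neg_ne_zero.2 hg
  have key := eq_apply_zero_of_forall_add_one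
    (f := fun i : ℤ => ((i.negOnePow : ℤ) : ℂ) * (-g) ^ (-p.level i) * p.vec i) (fun i => ?_) i
  · simp only [p.level_zero, neg_zero, zpow_zero, Int.negOnePow_zero, Units.val_one, Int.cast_one,
      one_mul] at key
    have hs : ((i.negOnePow : ℤ) : ℂ) * ((i.negOnePow : ℤ) : ℂ) = 1 := by
      rcases Int.even_or_odd i with h | h
      · simp [Int.negOnePow_even i h]
      · simp [Int.negOnePow_odd i h]
    have hz : (-g) ^ p.level i * (-g) ^ (-p.level i) = 1 := by
      rw [zpow_neg, mul_inv_cancel₀ (zpow_ne_zero _ hg')]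
    rw [← key]
    linear_combination (-p.vec i * (-g) ^ p.level i * (-g) ^ (-p.level i)) * hs - p.vec i * hz
  · simp only [Int.negOnePow_succ]
    rcases p.step i with ⟨h1, h2, -⟩ | ⟨h1, h2, -⟩ | ⟨h1, h2, -⟩
    · rw [h1, h2, show -p.level i = -(p.level i + 1) + 1 by ring, zpow_add_one₀ hg']
      push_cast
      ring
    · rw [h1, h2, show -(p.level i - 1) = -p.level i + 1 by ring, zpow_add_one₀ hg']
      push_cast
      ring
    · rw [h1, h2]
      push_cast
      ring

/-- The closed leaf of a path on the surface with levels modulo a divisor `N` of the total turning.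
-/
def leaf (hg : g ≠ 0) {N : ℕ} (hN : ∃ w, p.turns = N * w) :
    (rotationSurface hg N).ClosedLeaf n where
  tile i := (p.vec i, (p.level i : ZMod N))
  pos := p.ht
  step i := by
    rcases p.step i with ⟨h1, h2, h3, h4, h5⟩ | ⟨h1, h2, h3, h4, h5⟩ | ⟨h1, h2, h3, h4, h5⟩
    · exact Or.inl ⟨by simp [rotationSurface, h1, h2], h3, h4, h5⟩
    · exact Or.inr (Or.inl ⟨by simp [rotationSurface, h1, ← h2], h3, h4, h5⟩)
    · exact Or.inr (Or.inr ⟨by simp [rotationSurface, h1, h2], h3, h4, h5⟩)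
  tile_add i := by
    obtain ⟨w, hw⟩ := hN
    rw [p.vec_add, p.level_add, hw]
    simp
  pos_add := p.ht_add

/-- If `(-g) ^ N = ±1`, the level modulo `N` determines the first leg up to sign: the path visits
only two fans, exchanged by the half-turn. -/
theorem vec_eq_or_eq_neg_of_level_eq (hg : g ≠ 0) {N : ℕ} (hN : ((-g) ^ N) ^ 2 = 1) {i j : ℤ}
    (h : (p.level i : ZMod N) = j) :
    p.vec i = (-g) ^ j * p.vec 0 ∨ p.vec i = -((-g) ^ j * p.vec 0) := by
  have hg' : -g ≠ 0 := neg_ne_zero.2 hg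
  rw [eq_comm, ZMod.intCast_eq_intCast_iff_dvd_sub] at h
  obtain ⟨c, hc⟩ := h
  have e : p.level i = j + N * c := by linarith
  have hpow : (-g) ^ ((N : ℤ) * c) = 1 ∨ (-g) ^ ((N : ℤ) * c) = -1 := by
    rw [zpow_mul, zpow_natCast, ← sq_eq_one_iff, ← zpow_natCast, ← zpow_mul, mul_comm c, zpow_mul]
    simp [hN]
  have hs : ((i.negOnePow : ℤ) : ℂ) = 1 ∨ ((i.negOnePow : ℤ) : ℂ) = -1 := by
    rcases Int.even_or_odd i with h | h
    · simp [Int.negOnePow_even i h]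
    · simp [Int.negOnePow_odd i h]
  rw [p.vec_eq hg, e, zpow_add₀ hg']
  rcases hpow with h1 | h1 <;> rcases hs with h2 | h2 <;> rw [h1, h2] <;> simp

/-- Every leg in the two fans is crossed by the leaf, with signs, as often as the leaf winds around
the fans, that is `turns / N` times. -/
theorem leaf_hasFlux (hg : g ≠ 0) {N : ℕ} (hN : ((-g) ^ N) ^ 2 = 1) {w : ℤ}
    (hw : p.turns = N * w) (h0 : N = 0 → w = 0) : (p.leaf hg ⟨w, hw⟩).HasFlux w := by
  set γ := p.leaf hg ⟨w, hw⟩ with hγ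
  have main : ∀ (y : ℂ) (j : ℤ), (y = (-g) ^ j * p.vec 0 ∨ y = -((-g) ^ j * p.vec 0)) → 0 < y.im →
      γ.signedCount (y, (j : ZMod N)) (Set.Ioo 0 y.im) = -w := by
    intro y j hy hpos
    have hyj : ∀ i, (p.level i : ZMod N) = j → p.vec i = y ∨ p.vec i = -y := by
      intro i hi
      rcases hy with rfl | rfl
      · exact p.vec_eq_or_eq_neg_of_level_eq hg hN hi
      · rw [neg_neg]
        exact (p.vec_eq_or_eq_neg_of_level_eq hg hN hi).symm
    -- `ψ` applied to the level of the leaf changes exactly when the leg `y`, or its image `-y`, is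
    -- crossed.
    obtain ⟨ψ, hψ, hψ'⟩ := exists_level_potential hw h0 (j : ZMod N)
    have pw : ∀ i : ℤ, ψ (p.level (i + 1)) - ψ (p.level i) =
        γ.ind (-y, (j : ZMod N)) (-Set.Ioo 0 y.im) (i + 1) -
          γ.ind (y, (j : ZMod N)) (Set.Ioo 0 y.im) i := by
      intro i
      have ind1 : ∀ i, γ.ind (y, (j : ZMod N)) (Set.Ioo 0 y.im) i =
          if (p.vec i = y ∧ (p.level i : ZMod N) = j) ∧ 0 < p.ht i ∧ p.ht i < y.im
            then 1 else 0 := by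
        intro i
        unfold FanSurface.ClosedLeaf.ind
        congr 1
        simp [hγ, leaf, Prod.ext_iff]
      have ind2 : ∀ i, γ.ind (-y, (j : ZMod N)) (-Set.Ioo 0 y.im) i =
          if (p.vec i = -y ∧ (p.level i : ZMod N) = j) ∧ p.ht i < 0 ∧ -y.im < p.ht i
            then 1 else 0 := by
        intro i
        unfold FanSurface.ClosedLeaf.ind
        congr 1
        simp [hγ, leaf, Prod.ext_iff, rotationSurface]
        exact fun _ _ => and_comm
      rw [ind1, ind2]
      rcases p.step i with ⟨h1, h2, h3, h4, h5⟩ | ⟨h1, h2, h3, h4, h5⟩ | ⟨h1, h2, h3, h4, h5⟩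
      · rw [h1, hψ, if_neg (c := _ ∧ _ ∧ _ < y.im) (fun h => by linarith [h.2.1]), sub_zero]
        by_cases hc : ((p.level i + 1 : ℤ) : ZMod N) = j
        · have hv : p.vec (i + 1) = -y := (hyj (i + 1) (by rw [h1, hc])).resolve_left
            fun h => by rw [h] at h4; linarith
          rw [hv, Complex.neg_im] at h4
          rw [if_pos hc, if_pos ⟨⟨hv, hc⟩, by linarith, by linarith⟩]
        · rw [if_neg hc, if_neg fun h => hc h.1.2]
      · have hψi := hψ (p.level i - 1)
        rw [sub_add_cancel] at hψi
        rw [h1, if_neg (c := _ ∧ _ ∧ _ < p.ht (i + 1)) (fun h => by linarith [h.2.1]), zero_sub,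
          ← neg_sub, hψi, neg_inj]
        by_cases hc : (p.level i : ZMod N) = j
        · have hv : p.vec i = y := (hyj i hc).resolve_right
            fun h => by rw [h, Complex.neg_im] at h5; linarith
          rw [hv] at h5
          rw [if_pos hc, if_pos ⟨⟨hv, hc⟩, h4, h5⟩]
        · rw [if_neg hc, if_neg fun h => hc h.1.2]
      · rw [h1, sub_self, if_neg, if_neg, sub_self]
        · rintro ⟨⟨hv, -⟩, -, h6⟩
          rw [hv] at h4
          linarith
        · rintro ⟨⟨hv, -⟩, -, h6⟩
          rw [h2, neg_inj] at hv
          rw [hv] at h3 h4 h5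
          linarith
    have hsum : ∑ i ∈ Finset.range n, (ψ (p.level ((i : ℤ) + 1)) - ψ (p.level i)) = w := by
      have := Finset.sum_range_sub (fun i : ℕ => ψ (p.level i)) n
      push_cast at this
      rw [this, ← zero_add (n : ℤ), p.level_add, hψ']
      ring
    simp only [pw, Finset.sum_sub_distrib] at hsum
    rw [sum_range_intCast_add_one (γ.ind_periodic _ _)] at hsum
    change γ.count _ _ - γ.count _ _ = w at hsum
    rw [FanSurface.ClosedLeaf.signedCount]
    have e : (rotationSurface hg N).inv (y, (j : ZMod N)) = (-y, (j : ZMod N)) := rfl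
    rw [e]
    linarith
  have main' : ∀ (y : ℂ) (j : ℤ), (y = (-g) ^ j * p.vec 0 ∨ y = -((-g) ^ j * p.vec 0)) →
      (0 < y.im → γ.signedCount (y, (j : ZMod N)) (Set.Ioo 0 y.im) = -w) ∧
      (y.im < 0 → γ.signedCount (y, (j : ZMod N)) (Set.Ioo y.im 0) = w) := by
    refine fun y j hy => ⟨main y j hy, fun hneg => ?_⟩
    have h := main (-y) j (by rw [neg_inj, neg_eq_iff_eq_neg]; exact hy.symm)
      (by rw [Complex.neg_im]; linarith)
    have e1 : (rotationSurface hg N).inv (y, (j : ZMod N)) = (-y, (j : ZMod N)) := rfl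
    have e2 : (rotationSurface hg N).inv (-y, (j : ZMod N)) = (y, (j : ZMod N)) := by
      rw [← e1, FanSurface.inv_inv]
    rw [FanSurface.ClosedLeaf.signedCount, e2, Set.neg_Ioo, Complex.neg_im, neg_neg, neg_zero] at h
    rw [FanSurface.ClosedLeaf.signedCount, e1, Set.neg_Ioo, neg_zero]
    linarith
  have hlev : ∀ i, p.vec i = (-g) ^ p.level i * p.vec 0 ∨ p.vec i = -((-g) ^ p.level i * p.vec 0) :=
    fun i => p.vec_eq_or_eq_neg_of_level_eq hg hN rfl
  rintro i y (rfl | rfl)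
  · exact main' _ _ (hlev i)
  · have := main' (g * p.vec i) (p.level i + 1) (by
      rw [zpow_add_one₀ (neg_ne_zero.2 hg)]
      rcases hlev i with h | h
      · right; rw [h]; ring
      · left; rw [h]; ring)
    push_cast at this
    exact this

end FanPath

/-! ### Symmetries of paths with and without turning -/

namespace FanPath
variable {g : ℂ} {n : ℕ} (p : FanPath g n)

theorem negOnePow_eq_of_vec_eq_mul (hg : g ≠ 0) {i : ℤ} {c : ℂ} (h : p.vec i = c * p.vec 0) :
    ((i.negOnePow : ℤ) : ℂ) * (-g) ^ p.level i = c :=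
  mul_right_cancel₀ p.vec_ne_zero (by rw [← p.vec_eq hg, h])

/-- If the total turning vanishes, the leaf is closed for levels in `ℤ`, and its flux is `0`. It
cannot have `0` periods, so it is its own reversed image; as this turns the first tile by a
half-turn without changing the level, it is about an odd index. -/
theorem exists_reverse_of_turns_eq_zero (hg : g ≠ 0) (hn : 0 < n) (ht : p.turns = 0) :
    ∃ r : ℤ, Odd r ∧ ∀ i, p.level (r - i) = p.level i := by
  classical
  have hw : p.turns = ((0 : ℕ) : ℤ) * 0 := by simp [ht]
  have hflux := p.leaf_hasFlux hg (N := 0) (w := 0) (by simp) hw (fun _ => rfl)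
  rcases hflux.exists_reverse_or_card hn with ⟨r, hr⟩ | hcard
  · have hlev : ∀ i, p.level (r - i) = p.level i := by
      intro i
      have h2 : ((p.level (r - i) : ℤ) : ZMod 0) = (p.level i : ℤ) := (Prod.ext_iff.1 (hr i)).2
      exact h2
    refine ⟨r, ?_, hlev⟩
    have h0 : -p.vec (r - 0) = p.vec 0 := (Prod.ext_iff.1 (hr 0)).1
    have h1 := hlev 0
    rw [sub_zero] at h0 h1
    have h3 := p.negOnePow_eq_of_vec_eq_mul hg (i := r) (c := -1) (by rw [← h0]; ring)
    rw [h1, p.level_zero, zpow_zero, mul_one] at h3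
    rcases Int.even_or_odd r with h | h
    · rw [Int.negOnePow_even r h] at h3
      norm_num at h3
    · exact h
  · exfalso
    rw [abs_zero, Nat.cast_eq_zero, Finset.card_eq_zero] at hcard
    exact Finset.ne_empty_of_mem (Finset.mem_filter.2 ⟨Finset.mem_range.2 hn, fun i => by simp⟩)
      hcard

theorem vec_ne (hg : g ≠ 0) (i : ℤ) : p.vec i ≠ 0 := by
  rw [p.vec_eq hg]
  refine mul_ne_zero (mul_ne_zero ?_ (zpow_ne_zero _ (neg_ne_zero.2 hg))) p.vec_ne_zero
  exact_mod_cast i.negOnePow.ne_zero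

/-- The half-turn preserves the sense of rotation and reversing the path inverts it, so a path that
is its own reversed image does not turn in total. -/
theorem turns_eq_zero_of_reverse (hg : g ≠ 0) (hg1 : g ≠ -1) (hg2 : g * g ≠ 1) {r : ℤ}
    (h : ∀ i, -p.vec (r - i) = p.vec i) : p.turns = 0 := by
  have hstep : ∀ i, p.level (r - i) - p.level (r - i - 1) = -(p.level (i + 1) - p.level i) := by
    intro i
    have h1 := p.tileMove (r - i - 1)
    have h2 := (p.tileMove i).reverse
    rw [← h i, ← h (i + 1), neg_neg, neg_neg, ← sub_sub] at h2
    rw [sub_add_cancel] at h1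
    exact h1.unique hg1 hg2 (p.vec_ne hg _) h2
  have hconst := eq_apply_zero_of_forall_add_one (f := fun i => p.level (r - i) - p.level i)
    (fun i => by
      have := hstep i
      rw [← sub_sub]
      linarith) (-n)
  have h1 := p.level_add r
  have h2 := p.level_add (-n)
  simp only [sub_neg_eq_add, sub_zero] at hconst
  rw [neg_add_cancel] at h2
  linarith

/-- If the total turning is `N w ≠ 0`, the leaf has exactly `|w|` periods among its first `n`
indices, so it turns by `±N` tiles in one minimal period `r`. The factor `(-g) ^ (±N) = -1` of the
first leg has to be compensated by `(-1) ^ r`, so `r` is odd. -/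
theorem exists_shift_of_turns_ne_zero (hg : g ≠ 0) (hg1 : g ≠ -1) (hg2 : g * g ≠ 1) (hn : 0 < n)
    {N : ℕ} (hN : (-g) ^ N = -1) {w : ℤ} (hw : p.turns = N * w) (ht : p.turns ≠ 0) :
    ∃ r : ℤ, Odd r ∧ ∀ i,
      p.level (r + (i + 1)) - p.level (r + i) = p.level (i + 1) - p.level i := by
  classical
  have hN0 : N ≠ 0 := by rintro rfl; simp [hw] at ht
  have hflux := p.leaf_hasFlux hg (by rw [hN]; norm_num) hw (fun h => absurd h hN0)
  rcases hflux.exists_reverse_or_card hn with ⟨r, hr⟩ | hcard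
  · exact absurd (p.turns_eq_zero_of_reverse hg hg1 hg2 fun i => (Prod.ext_iff.1 (hr i)).1) ht
  set γ := p.leaf hg ⟨w, hw⟩ with hγ
  set Q : ℕ → Prop := fun j => ∀ i : ℤ, γ.tile (j + i) = γ.tile i ∧ γ.pos (j + i) = γ.pos i with hQ
  have hQn : Q n := fun i => by
    rw [add_comm]; exact ⟨γ.tile_add i, γ.pos_add i⟩
  have hex : ∃ j, 0 < j ∧ Q j := ⟨n, hn, hQn⟩
  obtain ⟨r, hr⟩ : ∃ r, r = Nat.find hex := ⟨_, rfl⟩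
  obtain ⟨hr0, hrQ⟩ : 0 < r ∧ Q r := hr ▸ Nat.find_spec hex
  have hmul : ∀ c : ℕ, Q (c * r) := by
    intro c
    induction c with
    | zero => intro i; simp
    | succ c ih =>
      intro i
      have h1 := hrQ (((c * r : ℕ) : ℤ) + i)
      have h2 := ih i
      rw [show (((c + 1) * r : ℕ) : ℤ) + i = (r : ℤ) + (((c * r : ℕ) : ℤ) + i) by push_cast; ring]
      exact ⟨h1.1.trans h2.1, h1.2.trans h2.2⟩
  have hdvd : ∀ j, Q j ↔ r ∣ j := by
    refine fun j => ⟨fun hj => ?_, ?_⟩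
    · have hmod : Q (j % r) := by
        intro i
        have h1 := hmul (j / r) (((j % r : ℕ) : ℤ) + i)
        have h2 := hj i
        have e : ((j / r * r : ℕ) : ℤ) + (((j % r : ℕ) : ℤ) + i) = (j : ℤ) + i := by
          rw [← add_assoc, ← Nat.cast_add, Nat.div_add_mod']
        rw [e] at h1
        exact ⟨h1.1.symm.trans h2.1, h1.2.symm.trans h2.2⟩
      rcases Nat.eq_zero_or_pos (j % r) with h | h
      · exact Nat.dvd_of_mod_eq_zero h
      · exact absurd ⟨h, hmod⟩ (Nat.find_min hex (hr ▸ Nat.mod_lt j hr0))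
    · rintro ⟨c, rfl⟩
      rw [mul_comm]
      exact hmul c
  obtain ⟨q, hq⟩ := (hdvd n).1 hQn
  -- The periods among the first `n` indices are `0, r, …, (q - 1) r`.
  have hcardq : ((Finset.range n).filter Q).card = q := by
    have : (Finset.range n).filter Q = (Finset.range q).image (fun c => r * c) := by
      ext j
      simp only [Finset.mem_filter, Finset.mem_range, Finset.mem_image, hdvd]
      constructor
      · rintro ⟨h1, c, rfl⟩
        exact ⟨c, lt_of_mul_lt_mul_left (hq ▸ h1) hr0.le, rfl⟩
      · rintro ⟨c, h1, rfl⟩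
        exact ⟨hq ▸ Nat.mul_lt_mul_of_pos_left h1 hr0, dvd_mul_right _ _⟩
    rw [this, Finset.card_image_of_injective _ (fun a b h => Nat.eq_of_mul_eq_mul_left hr0 h),
      Finset.card_range]
  have hqw : (q : ℤ) = |w| := by rw [← hcard, ← hcardq]
  have hvec : ∀ i, p.vec (r + i) = p.vec i := fun i => (Prod.ext_iff.1 (hrQ i).1).1
  have hstep : ∀ i, p.level (r + (i + 1)) - p.level (r + i) = p.level (i + 1) - p.level i := by
    intro i
    have h1 := p.tileMove (r + i)
    rw [add_assoc, hvec, hvec] at h1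
    exact h1.unique hg1 hg2 (p.vec_ne hg _) (p.tileMove i)
  have hconst : ∀ i, p.level (r + i) - p.level i = p.level r := by
    intro i
    have := eq_apply_zero_of_forall_add_one (f := fun i => p.level (r + i) - p.level i)
      (fun i => by have := hstep i; linarith) i
    simpa [p.level_zero] using this
  have hlevmul : ∀ c : ℕ, p.level (r * c) = c * p.level r := by
    intro c
    induction c with
    | zero => simp [p.level_zero]
    | succ c ih =>
      have := hconst (r * c)
      push_cast
      rw [show (r : ℤ) * (c + 1) = r + r * c by ring]
      linarith
  have hD : p.level r * q = N * w := by
    have h1 := hlevmul q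
    have h2 := p.level_add 0
    rw [show (0 : ℤ) + n = r * q by rw [hq]; push_cast; ring, h1, p.level_zero, zero_add, hw] at h2
    rw [← h2]; ring
  have hw0 : w ≠ 0 := by rintro rfl; simp [hw] at ht
  have hDN : p.level r = N ∨ p.level r = -N := by
    rw [hqw] at hD
    rcases abs_choice w with h | h <;> rw [h] at hD
    · left; exact mul_right_cancel₀ hw0 hD
    · right; exact mul_right_cancel₀ hw0 (by linarith)
  refine ⟨r, ?_, hstep⟩
  have h3 := p.negOnePow_eq_of_vec_eq_mul hg (i := r) (c := 1) (by
    have := hvec 0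
    rw [add_zero] at this
    rw [this, one_mul])
  have h4 : (-g) ^ p.level r = -1 := by
    rcases hDN with h | h <;> rw [h]
    · rw [zpow_natCast, hN]
    · rw [zpow_neg, zpow_natCast, hN]; norm_num
  rw [h4] at h3
  rcases Int.even_or_odd r with h | h
  · rw [Int.negOnePow_even _ h] at h3
    norm_num at h3
  · exact h

end FanPath

theorem apexRotation_ne_zero (θ : ℝ) : apexRotation θ ≠ 0 :=
  neg_ne_zero.2 (Complex.exp_ne_zero _)

theorem neg_apexRotation_zpow (θ : ℝ) (k : ℤ) :
    (-apexRotation θ) ^ k = Complex.exp ((-(2 * θ * k) : ℝ) * Complex.I) := by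
  rw [apexRotation, neg_neg, ← Complex.exp_int_mul]
  congr 1
  push_cast
  ring

/-- The arithmetic of the base angle. If `θ = (a / b) π` with `a`, `b` coprime and `b = 2 d`, then
`b` divides `M`, and `N = |d|` has the property, as `a` is odd. -/
theorem exists_nat_of_baseAngleCondition {θ : ℝ} (h : BaseAngleCondition θ) {M : ℤ}
    (hM : (-apexRotation θ) ^ M = 1) (hM0 : M ≠ 0) :
    ∃ (N : ℕ) (w : ℤ), (-apexRotation θ) ^ N = -1 ∧ M = N * w := by
  rw [neg_apexRotation_zpow, Complex.exp_eq_one_iff] at hM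
  obtain ⟨z, hz⟩ := hM
  have hz' : -(2 * θ * M) = z * (2 * π) := by
    have h1 : ((-(2 * θ * M) : ℝ) : ℂ) = ((z * (2 * π) : ℝ) : ℂ) := by
      apply mul_right_cancel₀ Complex.I_ne_zero
      rw [hz]; push_cast; ring
    exact_mod_cast h1
  have hMr : (M : ℝ) ≠ 0 := by exact_mod_cast hM0
  -- If `θ / π` is irrational, no power with a nonzero exponent `M` is `1`.
  rcases h with h | ⟨a, b, hb, hab, hbe, rfl⟩
  · exfalso
    rw [irrational_iff_ne_rational] at h
    refine h (-z) M hM0 ?_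
    push_cast
    rw [div_eq_div_iff pi_ne_zero hMr]
    linarith
  · have hbr : (b : ℝ) ≠ 0 := by exact_mod_cast hb
    have h1 : a * M = b * (-z) := by
      have h2 : (a : ℝ) * M = b * (-z) := by
        field_simp at hz'
        linarith
      exact_mod_cast h2
    obtain ⟨c, hc⟩ : b ∣ M := hab.symm.dvd_of_dvd_mul_left ⟨-z, h1⟩
    obtain ⟨d, hd⟩ := hbe
    have hodd : Odd a := by
      rcases Int.even_or_odd a with ⟨x, hx⟩ | ha
      · exfalso
        obtain ⟨s, t, hst⟩ := hab
        rw [hx, hd] at hst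
        have : (2 : ℤ) * (s * x + t * d) = 1 := by linarith
        omega
      · exact ha
    have hpow : (-apexRotation ((a : ℝ) / b * π)) ^ d = -1 := by
      rw [neg_apexRotation_zpow]
      have e : (-(2 * ((a : ℝ) / b * π) * d) : ℝ) = -(a * π) := by
        have : (b : ℝ) = d + d := by exact_mod_cast hd
        have hd0 : (d : ℝ) ≠ 0 := by
          rintro h0; rw [h0] at this; simp at this; exact hb this
        rw [this]
        field_simp
        ring
      rw [e]
      have e2 : ((-(a * π) : ℝ) : ℂ) * Complex.I = ((-a : ℤ) : ℂ) * (π * Complex.I) := by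
        push_cast; ring
      rw [e2, Complex.exp_int_mul, Complex.exp_pi_mul_I]
      exact hodd.neg.neg_one_zpow
    refine ⟨d.natAbs, d.sign * (2 * c), ?_, ?_⟩
    · rcases Int.natAbs_eq d with h | h
      · rw [h, zpow_natCast] at hpow
        exact hpow
      · rw [h, zpow_neg, zpow_natCast, inv_eq_iff_eq_inv] at hpow
        rw [hpow]; norm_num
    · rw [← mul_assoc, mul_comm (d.natAbs : ℤ), Int.sign_mul_natAbs, hc, hd]
      ring

namespace BilliardPolygon
variable {θ : ℝ} {v : Fin 3 → ℂ} {n : ℕ} {e : ℤ → Fin 3}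

theorem negOnePow_add_add (i : ℤ) (n : ℕ) : (i + (n + n : ℕ)).negOnePow = i.negOnePow := by
  rw [Int.negOnePow_add, Int.negOnePow_even ((n + n : ℕ) : ℤ) (by push_cast; exact ⟨n, rfl⟩),
    mul_one]

/-- The path of the unfolded trajectory, traversed twice so that its unfolding preserves
orientation. -/
theorem exists_fanPath (B : BilliardPolygon v n e) (hv : v = triangleVertex (θ, θ))
    (hT : (θ, θ) ∈ triangleSpace) : ∃ p : FanPath (apexRotation θ) (n + n),
      ∀ i, p.level (i + 1) - p.level i = (i.negOnePow : ℤ) * turn (e (i + 1)) := by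
  obtain ⟨k, hk0, hk⟩ := exists_int_antidifference (fun i => (i.negOnePow : ℤ) * turn (e (i + 1)))
  have hconst := eq_apply_zero_of_forall_add_one (f := fun i => k (i + (n + n : ℕ)) - k i)
    (fun i => by
      have h1 := B.double.edge_add (i + 1)
      rw [add_right_comm, hk, hk, negOnePow_add_add, add_right_comm, h1]
      ring)
  refine ⟨{ vec := B.tileVector, ht := B.apexHeight, level := k, turns := k (n + n : ℕ),
            step := fun i => ?_, vec_ne_zero := B.tileVector_ne_zero hv hT 0, level_zero := hk0,
            vec_add := fun i => ?_, ht_add := fun i => ?_, level_add := fun i => ?_ },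
          fun i => (sub_eq_iff_eq_add'.2 (hk i))⟩
  · have hki := hk i
    rcases B.isosceles_step hv hT i with ⟨h, h'⟩ | ⟨h, h'⟩ | ⟨h, h'⟩ <;> rw [h] at hki
    · exact Or.inl ⟨hki, h'⟩
    · exact Or.inr (Or.inl ⟨hki, h'⟩)
    · exact Or.inr (Or.inr ⟨by rw [hki, add_zero], h'⟩)
  · have h' : Even (i + (n + n : ℕ)) ↔ Even i := by
      rw [Int.even_add]
      exact iff_true_right (by push_cast; exact ⟨n, rfl⟩)
    simp only [tileVector, unfolded_periodic, h']
  · rw [apexHeight, apexHeight, unfolded_periodic, 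
      show B.pt (i + (n + n : ℕ)) = B.pt i from B.double.pt_add i]
  · have := hconst i
    simp only [zero_add, hk0, sub_zero] at this
    linarith

/-- The labels of a periodic trajectory in an isosceles triangle whose base angle satisfies the
condition are exchanged, `0` against `1`, by a shift or by a reversal. A shift or a reversal of the
levels about an odd index reverses the parity of the segments, hence the sense of `turn`. -/
theorem exists_swap_symmetry (B : BilliardPolygon v n e) (hv : v = triangleVertex (θ, θ))
    (hT : (θ, θ) ∈ triangleSpace) (hθ : BaseAngleCondition θ) (hn : 0 < n) :
    ∃ r : ℤ, (∀ i, e (i + r) = Equiv.swap 0 1 (e i)) ∨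
      (∀ i, e (r - i) = Equiv.swap 0 1 (e i)) := by
  obtain ⟨p, hp⟩ := B.exists_fanPath hv hT
  have hg := apexRotation_ne_zero θ
  have him : (apexRotation θ).im ≠ 0 := by
    rw [apexRotation_im]
    have := hT.1; have := hT.2.1; simp only at *
    exact (sin_pos_of_pos_of_lt_pi (by linarith) (by linarith)).ne'
  have hg1 : apexRotation θ ≠ -1 := fun h => him (by rw [h]; simp)
  have hg2 : apexRotation θ * apexRotation θ ≠ 1 := fun h => by
    rcases mul_self_eq_one_iff.1 h with h | h
    · exact him (by rw [h]; simp)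
    · exact hg1 h
  by_cases ht : p.turns = 0
  · obtain ⟨r, hr, hlev⟩ := p.exists_reverse_of_turns_eq_zero hg (by omega) ht
    refine ⟨r + 1, Or.inr fun i => turn_injective ?_⟩
    have h1 := hp (i - 1)
    have h2 := hp (r - i)
    rw [sub_add_cancel] at h1
    have h3 := hlev i
    have h4 := hlev (i - 1)
    rw [show r - (i - 1) = r - i + 1 by ring] at h4
    have h5 : (r - i).negOnePow = (i - 1).negOnePow := by
      rw [Int.negOnePow_sub, Int.negOnePow_sub, Int.negOnePow_odd r hr,
        Int.negOnePow_one, mul_comm]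
    rw [h4, h3, h5] at h2
    rw [turn_swap, show r + 1 - i = r - i + 1 by ring]
    have h6 : (((i - 1).negOnePow : ℤˣ) : ℤ) ≠ 0 := Units.ne_zero _
    apply mul_left_cancel₀ h6
    rw [← h2, mul_neg, ← h1]
    ring
  · have hM : (-apexRotation θ) ^ p.turns = 1 := by
      have h1 := p.negOnePow_eq_of_vec_eq_mul hg (i := 0 + (n + n : ℕ)) (c := 1)
        (by rw [p.vec_add, one_mul])
      rw [p.level_add, p.level_zero, negOnePow_add_add, zero_add] at h1
      simpa using h1
    obtain ⟨N, w, hN, hw⟩ := exists_nat_of_baseAngleCondition hθ hM ht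
    obtain ⟨r, hr, hlev⟩ := p.exists_shift_of_turns_ne_zero hg hg1 hg2 (by omega) hN hw ht
    refine ⟨r, Or.inl fun i => turn_injective ?_⟩
    have h1 := hp (i - 1)
    have h2 := hp (r + (i - 1))
    have h3 := hlev (i - 1)
    rw [sub_add_cancel] at h1 h3
    rw [show r + (i - 1) + 1 = r + i by ring, h3, h1, Int.negOnePow_add,
      Int.negOnePow_odd r hr] at h2
    rw [turn_swap, add_comm]
    have h6 : (((i - 1).negOnePow : ℤˣ) : ℤ) ≠ 0 := Units.ne_zero _
    apply mul_left_cancel₀ h6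
    push_cast at h2
    linarith

end BilliardPolygon

/-! ### Mirror images -/

/-- The reflection about the vertical through the midpoint of the base. It carries the triangle `T`
to the triangle with exchanged angles. -/
def mirror (T : ℝ × ℝ) (z : ℂ) : ℂ := (sin (T.1 + T.2) : ℝ) - conj z

theorem mirror_mirror (T : ℝ × ℝ) (z : ℂ) : mirror T.swap (mirror T z) = z := by
  simp only [mirror, map_sub, Complex.conj_ofReal, Complex.conj_conj, Prod.fst_swap, Prod.snd_swap,
    add_comm T.2 T.1]
  ring

theorem mirror_sub_mirror (T : ℝ × ℝ) (z w : ℂ) : mirror T z - mirror T w = -conj (z - w) := by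
  simp only [mirror, map_sub]
  ring

theorem mirror_combo (T : ℝ × ℝ) {a b : ℝ} (hab : a + b = 1) (z w : ℂ) :
    mirror T (a • z + b • w) = a • mirror T z + b • mirror T w := by
  obtain rfl : b = 1 - a := by linarith
  simp only [mirror, map_add, Complex.real_smul, map_mul, Complex.conj_ofReal, Complex.ofReal_sub,
    Complex.ofReal_one, map_sub, map_one]
  ring

theorem mirror_triangleVertex (T : ℝ × ℝ) (j : Fin 3) :
    mirror T (triangleVertex T j) = triangleVertex T.swap (Equiv.swap 0 1 j) := by
  refine forall_fin_three
    (fun j => mirror T (triangleVertex T j) = triangleVertex T.swap (Equiv.swap 0 1 j))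
    ?_ ?_ ?_ j
  · rw [Equiv.swap_apply_left, triangleVertex_zero, triangleVertex_one, mirror]
    apply Complex.ext <;> simp [add_comm T.2 T.1, -Complex.ofReal_sin]
  · rw [Equiv.swap_apply_right, triangleVertex_zero, triangleVertex_one, mirror]
    apply Complex.ext <;> simp [-Complex.ofReal_sin]
  · rw [show Equiv.swap (0 : Fin 3) 1 2 = 2 from by decide, triangleVertex_two, triangleVertex_two,
      mirror]
    apply Complex.ext
    · simp only [Complex.sub_re, Complex.ofReal_re, Complex.conj_re, Prod.fst_swap, Prod.snd_swap,
        sin_add]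
      ring
    · simp only [Complex.sub_im, Complex.ofReal_im, Complex.conj_im, Prod.fst_swap, Prod.snd_swap]
      ring

theorem mirror_mem_triangleRegion (T : ℝ × ℝ) {z : ℂ} (hz : z ∈ triangleRegion (triangleVertex T)) :
    mirror T z ∈ triangleRegion (triangleVertex T.swap) := by
  have hconv : Convex ℝ (mirror T ⁻¹' triangleRegion (triangleVertex T.swap)) := by
    intro x hx y hy a b ha hb hab
    rw [Set.mem_preimage, mirror_combo T hab]
    exact convex_convexHull ℝ _ hx hy ha hb hab
  refine convexHull_min ?_ hconv hz
  rintro _ ⟨j, rfl⟩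
  rw [Set.mem_preimage, mirror_triangleVertex]
  exact subset_convexHull ℝ _ ⟨_, rfl⟩

theorem mirror_mem_interior (T : ℝ × ℝ) {z : ℂ}
    (hz : z ∈ interior (triangleRegion (triangleVertex T))) :
    mirror T z ∈ interior (triangleRegion (triangleVertex T.swap)) := by
  have hcont : Continuous (mirror T.swap) := by unfold mirror; fun_prop
  have h1 : mirror T z ∈ mirror T.swap ⁻¹' interior (triangleRegion (triangleVertex T)) := by
    rw [Set.mem_preimage, mirror_mirror]
    exact hz
  refine interior_mono (fun w hw => ?_) (preimage_interior_subset_interior_preimage hcont h1)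
  have := mirror_mem_triangleRegion T hw
  have e := mirror_mirror T.swap w
  rw [Prod.swap_swap] at e
  rwa [e] at this

theorem mirror_mem_openEdge (T : ℝ × ℝ) {j : Fin 3} {z : ℂ}
    (hz : z ∈ openEdge (triangleVertex T) j) :
    mirror T z ∈ openEdge (triangleVertex T.swap) (Equiv.swap 0 1 j) := by
  obtain ⟨a, b, ha, hb, hab, rfl⟩ := hz
  have hj : ∀ j : Fin 3, Equiv.swap (0 : Fin 3) 1 j + 1 = Equiv.swap 0 1 (j + 2) ∧
      Equiv.swap (0 : Fin 3) 1 j + 2 = Equiv.swap 0 1 (j + 1) := by decide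
  refine ⟨b, a, hb, ha, by linarith, ?_⟩
  rw [mirror_combo T hab, mirror_triangleVertex, mirror_triangleVertex, (hj j).1, (hj j).2,
    add_comm]

theorem edgeReflection_mirror {T : ℝ × ℝ} (hT : T ∈ triangleSpace) (j : Fin 3) (z : ℂ) :
    edgeReflection (triangleVertex T.swap) (Equiv.swap 0 1 j) (-conj z) =
      -conj (edgeReflection (triangleVertex T) j z) := by
  have hj : ∀ j : Fin 3, Equiv.swap (0 : Fin 3) 1 j + 1 = Equiv.swap 0 1 (j + 2) ∧
      Equiv.swap (0 : Fin 3) 1 j + 2 = Equiv.swap 0 1 (j + 1) := by decide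
  set a := triangleVertex T (j + 2) - triangleVertex T (j + 1) with ha
  have ha0 : a ≠ 0 := triangleVertex_sub_ne_zero hT j
  have ha' : triangleVertex T.swap (Equiv.swap 0 1 j + 2) -
      triangleVertex T.swap (Equiv.swap 0 1 j + 1) = conj a := by
    rw [(hj j).1, (hj j).2, ← mirror_triangleVertex, ← mirror_triangleVertex, mirror_sub_mirror,
      ← map_neg, neg_sub]
  have h1 : edgeReflection (triangleVertex T) j z * conj a = a * conj z :=
    reflection_span_singleton_mul_conj a z ha0
  have h2 : edgeReflection (triangleVertex T.swap) (Equiv.swap 0 1 j) (-conj z) * conj (conj a) =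
      conj a * conj (-conj z) := by
    rw [← ha']
    exact reflection_span_singleton_mul_conj _ _ (ha' ▸ (map_ne_zero _).2 ha0)
  rw [Complex.conj_conj] at h2
  apply mul_right_cancel₀ ha0
  rw [h2]
  have h3 := congrArg conj h1
  simp only [map_mul, Complex.conj_conj] at h3
  rw [map_neg, Complex.conj_conj, neg_mul, h3]
  ring

namespace BilliardPolygon

/-- The reflected trajectory, in the triangle with exchanged base angles. -/
def mirrorImage {T : ℝ × ℝ} (hT : T ∈ triangleSpace) {n : ℕ} {e : ℤ → Fin 3}
    (B : BilliardPolygon (triangleVertex T) n e) :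
    BilliardPolygon (triangleVertex T.swap) n (fun i => Equiv.swap 0 1 (e i)) where
  pt i := mirror T (B.pt i)
  dir i := -conj (B.dir i)
  dur := B.dur
  pt_mem i := mirror_mem_openEdge T (B.pt_mem i)
  dur_pos := B.dur_pos
  pt_succ i := by
    rw [B.pt_succ, ← sub_eq_iff_eq_add', mirror_sub_mirror, add_sub_cancel_left]
    simp
  segment_subset i := by
    rintro _ ⟨a, b, ha, hb, hab, rfl⟩
    rw [← mirror_combo T hab]
    exact mirror_mem_interior T (B.segment_subset i ⟨a, b, ha, hb, hab, rfl⟩)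
  dir_succ i := by rw [edgeReflection_mirror hT, ← B.dir_succ]
  dir_ne_zero := neg_ne_zero.2 ((map_ne_zero _).2 B.dir_ne_zero)
  edge_add i := by rw [B.edge_add]
  pt_add i := by rw [B.pt_add]
  dir_add i := by rw [B.dir_add]
  dur_add := B.dur_add

end BilliardPolygon

/-- The mirror image of a trajectory has exchanged labels, and the symmetry of the label sequence
found in the isosceles triangle turns these back into `C`. -/
theorem swap_mem_orbitTile {C : List (Fin 3)} {θ : ℝ} (hθ : (θ, θ) ∈ orbitTile C)
    (hcond : BaseAngleCondition θ) {T : ℝ × ℝ} (hT : T ∈ orbitTile C) : T.swap ∈ orbitTile C := by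
  rw [mem_orbitTile_iff] at hθ hT ⊢
  obtain ⟨hiso, hn, ⟨B₀⟩⟩ := hθ
  obtain ⟨hT, -, ⟨B⟩⟩ := hT
  refine ⟨⟨hT.2.2.1, hT.2.2.2, hT.1, hT.2.1⟩, hn, ?_⟩
  obtain ⟨r, h | h⟩ := B₀.exists_swap_symmetry rfl hiso hcond hn
  · have B' := (B.mirrorImage hT).shift (-r)
    have e : (fun i => Equiv.swap 0 1 (cyclicLabels C (i + -r))) = cyclicLabels C := by
      funext i
      rw [← h, neg_add_cancel_right]
    exact ⟨e ▸ B'⟩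
  · have B' := (B.mirrorImage hT).reverse r
    have e : (fun i => Equiv.swap 0 1 (cyclicLabels C (r - i))) = cyclicLabels C := by
      funext i
      rw [← h, sub_sub_cancel]
    exact ⟨e ▸ B'⟩

end
theorem corollary1p6 (C : List (Fin 3)) (T : ℝ × ℝ) (hT : T ∈ orbitTile C)
    (hiso : T ∈ isoscelesLine) (hcond : BaseAngleCondition T.1) :
    Prod.swap '' orbitTile C = orbitTile C := by
  obtain ⟨θ, θ'⟩ := T
  obtain rfl : θ = θ' := hiso.2
  apply Set.Subset.antisymm
  · rintro _ ⟨S, hS, rfl⟩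
    exact swap_mem_orbitTile hT hcond hS
  · exact fun S hS => ⟨S.swap, swap_mem_orbitTile hT hcond hS, S.swap_swap⟩
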